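/- Let $\Omega\subset\mathbb R^k$ be compact and let $\mathcal P_1(\Omega)$ be the set of Borel probability measures on $\Omega$, with the Wasserstein distances $W_p$ ($p>1$) for the cost $|x-y|^p$. For a signed measure $\nu$ with Jordan decomposition $\nu=\nu_+-\nu_-$ put $\|\nu\|_{TV}=\nu_+(\Omega)+\nu_-(\Omega)$. Let $d>0$, $L,K>0$ and $N\ge 2$ an integer. A measure $\mu\in\mathcal P_1(\Omega)$ is called strongly $d$-connected with constants $L,K,N$ if there is a probability space $(D,\beta)$ such that for all $x_0,x_1\in\operatorname{supp}\mu$ there are points $y_1=x_0,y_2,\dots,y_n=x_1$ in $\operatorname{supp}\mu$, $1\le n\le N$, and measurable maps $\Phi_j:[0,1]\times D\to\operatorname{supp}\mu$, $1\le j\le n-1$, with the following properties: (i) $s\mapsto\Phi_j(s,b)$ is $L$-Lipschitz for every $b\in D$; (ii) $\Phi_j$ is injective on $(0,1)\times D$, and $\Phi_j(0,b)=y_j$, $\Phi_j(1,b)=y_{j+1}$ for every $b\in D$; (iii) $(\Phi_j)_\#\rho\le\mu$, where $\rho(ds,db)=K s^{d-1}(1-s)^{d-1}\,ds\,\beta(db)$.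 Let $I\subset\mathbb R$ be an interval, $1<r\le\infty$, and let $t\mapsto\mu_{(t)}\in\mathcal P_1(\Omega)$, $t\in I$, be a curve for which there is a non-negative $m\in L^r(I)$ with $\|\mu_{(t)}-\mu_{(\tau)}\|_{TV}\le\int_\tau^t m(s)\,ds$ for all $\tau<t$ in $I$. Assume that $\operatorname{supp}\mu_{(t)}\subseteq\operatorname{supp}\mu_{(\tau)}$ for all $\tau<t$ in $I$, and that there are constants $L,K,N$ independent of $t$ such that every $\mu_{(t)}$, $t\in I$, is strongly $d$-connected with constants $L,K,N$. Then for every $p>1$ with $p/(p-1)\ne d$ there is a constant $C$ such that, with $q=\min(1,1/d+1/p)$, $$W_p(\mu_{(t)},\mu_{(\tau)})\le C\,|t-\tau|^{q(r-1)/r}\qquad\text{for all }t,\tau\in I,$$ where $(r-1)/r$ is read as $1$ if $r=\infty$. If $r=\infty$ and $p>1$ satisfies $p/(p-1)=d$, then there is a constant $C$ such that $$W_p(\mu_{(t)},\mu_{(\tau)})\le C\,|t-\tau|\left[\left(\ln^+\frac1{|t-\tau|}\right)^{1/p}+1\right]\qquad\text{for all }t\ne\tau\text{ in }I,$$ where $\ln^+x=\max(0,\ln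 x)$. -/

import Mathlib

open MeasureTheory
open scoped ENNReal NNReal

universe v

/-- The `p`-Wasserstein distance of two Borel probability measures, with values in `[0, ∞]`:
the `p`-th root of the infimum of the `p`-cost over all couplings. -/
noncomputable def wasserstein {X : Type*} [PseudoEMetricSpace X] [MeasurableSpace X]
    (p : ℝ) (μ ν : ProbabilityMeasure X) : ℝ≥0∞ :=
  (⨅ π ∈ {π : Measure (X × X) | π.map Prod.fst = (μ : Measure X) ∧ π.map Prod.snd = (ν : Measure X)},
    ∫⁻ z, edist z.1 z.2 ^ p ∂π) ^ (1 / p)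

/-- The total variation norm `‖μ - ν‖ = (μ - ν)₊(X) + (μ - ν)₋(X)`. -/
noncomputable def tvDist {X : Type*} [MeasurableSpace X] (μ ν : ProbabilityMeasure X) : ℝ :=
  (((μ : Measure X).toSignedMeasure - (ν : Measure X).toSignedMeasure).totalVariation
    Set.univ).toReal

/-- The support of a probability measure. -/
def supp {X : Type*} [TopologicalSpace X] [MeasurableSpace X] (μ : ProbabilityMeasure X) : Set X :=
  (μ : Measure X).support

/-- Membership of a curve of probability measures in `AC^r(I; TV)`. -/
def IsACTV {X : Type*} [MeasurableSpace X] (I : Set ℝ) (r : ℝ≥0∞)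
    (μ : I → ProbabilityMeasure X) : Prop :=
  ∃ m : ℝ → ℝ, (∀ s, 0 ≤ m s) ∧ MemLp m r (volume.restrict I) ∧
    ∀ τ t : I, τ < t → tvDist (μ t) (μ τ) ≤ ∫ s in (τ : ℝ)..t, m s

/-- The measure `K s^(d-1) (1-s)^(d-1) ds dβ` on `[0,1] × D`. -/
noncomputable def tubeMeasure {D : Type*} [MeasurableSpace D] (d K : ℝ) (β : Measure D) :
    Measure (unitInterval × D) :=
  ((volume : Measure unitInterval).prod β).withDensity fun z =>
    ENNReal.ofReal (K * (z.1 : ℝ) ^ (d - 1) * (1 - (z.1 : ℝ)) ^ (d - 1))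

/-- `Φ : [0,1] × D → supp μ` is an admissible tube from `y` to `y'`. -/
structure IsTube {X : Type*} [PseudoMetricSpace X] [MeasurableSpace X] {D : Type*}
    [MeasurableSpace D] (d : ℝ) (L : ℝ≥0) (K : ℝ) (β : Measure D) (μ : ProbabilityMeasure X)
    (y y' : X) (Φ : unitInterval × D → X) : Prop where
  measurable : Measurable Φ
  mem_supp : ∀ z, Φ z ∈ supp μ
  lipschitz : ∀ b, LipschitzWith L fun s => Φ (s, b)
  injOn : Set.InjOn Φ {z | 0 < z.1 ∧ z.1 < 1}
  source : ∀ b, Φ (0, b) = y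
  target : ∀ b, Φ (1, b) = y'
  map_le : (tubeMeasure d K β).map Φ ≤ (μ : Measure X)

/-- `μ` is strongly `d`-connected with constants `L`, `K`, `N`. The parameter space `(D, β)` is
normalized to have mass one (its mass is absorbed in `K`), so that `K` is a meaningful constant.
The chain `y 0, …, y n` consists of `n + 1 ≤ N` points joined by `n` tubes. -/
def StronglyConnectedWith {X : Type*} [PseudoMetricSpace X] [MeasurableSpace X]
    (d : ℝ) (L : ℝ≥0) (K : ℝ) (N : ℕ) (μ : ProbabilityMeasure X) : Prop :=
  ∃ (D : Type v) (_ : MeasurableSpace D) (β : Measure D), IsProbabilityMeasure β ∧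
    ∀ x₀ ∈ supp μ, ∀ x₁ ∈ supp μ, ∃ (n : ℕ) (y : Fin (n + 1) → X)
      (Φ : Fin n → unitInterval × D → X),
      n + 1 ≤ N ∧ y 0 = x₀ ∧ y (Fin.last n) = x₁ ∧ (∀ j, y j ∈ supp μ) ∧
        ∀ j : Fin n, IsTube d L K β μ (y j.castSucc) (y j.succ) (Φ j)

/-- All members of the family are strongly `d`-connected, with common constants `L`, `K`, `N`. -/
def UniformlyStronglyConnected {T : Type*} {X : Type*} [PseudoMetricSpace X] [MeasurableSpace X]
    (d : ℝ) (μ : T → ProbabilityMeasure X) : Prop :=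
  ∃ (L : ℝ≥0) (K : ℝ) (N : ℕ), 0 < L ∧ 0 < K ∧ 2 ≤ N ∧
    ∀ t, StronglyConnectedWith.{v} d L K N (μ t)

/-!
By Kantorovich duality it suffices to bound `∫ φ dμ + ∫ ψ dν` for all continuous potentials with
`φ x + ψ y ≤ |x - y| ^ p`. This avoids gluing couplings: the tubes of a strongly connected measure
depend on their end points without any measurability, but for fixed potentials the parts `P = μ - ν`
and `Q = ν - μ` may be concentrated at a maximum point of `φ` and of `ψ`. So one only has to carry
`μ + e δ_x` to `μ + e δ_y` for points `x`, `y` of the support and `e` the total variation distance.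

Along a tube this is a shift of quantiles. The density `s ^ (d - 1)` has quantile function
`v ^ (1 / d)`, and moving it by `e` costs about `e ^ (1 + p / d) + e ^ p ∫ v ^ ((1 / d - 1) p) dv`
over `e ≤ v ≤ 1 + e`, whose behaviour as `e → 0` gives the three regimes of the exponent.

Since `P` has to travel through a copy of `μ`, which `μ - P` alone does not provide, this bounds
the cost from `μ + μ` to `μ + ν` only. Moving the remaining copy of `μ` costs as much as the
unknown cost `s` from `μ` to `ν`, and a weighted triangle inequality turns the bound on the first
move into one on `s`, because `2 s` is the cost from `μ + μ` to `ν + ν`.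
-/

/-! ### The dual transport problem -/

section HahnBanach

lemma exists_linearMap_eq_of_sublinear {E : Type*} [AddCommGroup E] [Module ℝ E] {N : E → ℝ}
    (N_hom : ∀ c : ℝ, 0 < c → ∀ x, N (c • x) = c * N x) (N_add : ∀ x y, N (x + y) ≤ N x + N y)
    (x₀ : E) : ∃ g : E →ₗ[ℝ] ℝ, g x₀ = N x₀ ∧ ∀ x, g x ≤ N x := by
  have N_zero : N 0 = 0 := by
    have h := N_hom 2 two_pos 0
    rw [smul_zero] at h
    linarith
  have N_smul (c : ℝ) : c * N x₀ ≤ N (c • x₀) := by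
    rcases lt_trichotomy c 0 with hc | rfl | hc
    · have h := N_add x₀ (-x₀)
      have h' := N_hom (-c) (neg_pos.2 hc) (-x₀)
      rw [add_neg_cancel, N_zero] at h
      rw [smul_neg, neg_smul, neg_neg] at h'
      nlinarith
    · simp [N_zero]
    · exact (N_hom c hc x₀).ge
  have hx₀ (c : ℝ) (h : c • x₀ = 0) : (RingHom.id ℝ) c • N x₀ = 0 := by
    rcases smul_eq_zero.1 h with rfl | rfl <;> simp [N_zero]
  obtain ⟨g, hgf, hgN⟩ := exists_extension_of_le_sublinear
    (LinearPMap.mkSpanSingleton' x₀ (N x₀) hx₀) N N_hom N_add fun ⟨x, hx⟩ => by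
      obtain ⟨c, rfl⟩ := Submodule.mem_span_singleton.1 hx
      rw [LinearPMap.mkSpanSingleton'_apply]
      exact N_smul c
  refine ⟨g, ?_, hgN⟩
  exact (hgf ⟨x₀, Submodule.mem_span_singleton_self x₀⟩).trans
    (LinearPMap.mkSpanSingleton'_apply_self x₀ (N x₀) hx₀ _)

end HahnBanach

section Dual

variable {X Y Z : Type*} [TopologicalSpace X] [MeasurableSpace X] [TopologicalSpace Y]
  [MeasurableSpace Y] [TopologicalSpace Z] [MeasurableSpace Z]

/-- `B` bounds the value of the dual Kantorovich problem for moving `μ` to `ν` with cost `c`. The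
measures need not be normalized. -/
def DualCostLE (c : X → Y → ℝ) (μ : Measure X) (ν : Measure Y) (B : ℝ) : Prop :=
  ∀ (φ : C(X, ℝ)) (ψ : C(Y, ℝ)), (∀ x y, φ x + ψ y ≤ c x y) → ∫ x, φ x ∂μ + ∫ y, ψ y ∂ν ≤ B

section CompactSpace

variable [CompactSpace X] [OpensMeasurableSpace X]

lemma integrable_continuousMap (μ : Measure X) [IsFiniteMeasure μ] (f : C(X, ℝ)) :
    Integrable f μ :=
  f.continuous.integrable_of_hasCompactSupport (.of_compactSpace f)

lemma integral_le_of_forall_mem {ρ : Measure X} [IsFiniteMeasure ρ] (φ : C(X, ℝ)) {S : Set X}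
    (hS : S ∈ ae ρ) {M : ℝ} (hM : ∀ x ∈ S, φ x ≤ M) : ∫ x, φ x ∂ρ ≤ ρ.real Set.univ * M := by
  have h := integral_mono_ae (integrable_continuousMap ρ φ) (integrable_const M)
    (Filter.mem_of_superset hS hM)
  simpa using h

variable {S D : Type*} [MeasurableSpace S] [MeasurableSpace D] (θ : Measure S) [IsFiniteMeasure θ]
  (β : Measure D) [IsProbabilityMeasure β] {ρ : Measure X} [IsFiniteMeasure ρ] {Φ : S × D → X}

lemma integral_map_slice_add (hΦ : Measurable Φ) (φ : C(X, ℝ)) (b : D) :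
    ∫ x, φ x ∂(θ.map (fun s => Φ (s, b)) + ρ) = ∫ s, φ (Φ (s, b)) ∂θ + ∫ x, φ x ∂ρ := by
  rw [integral_add_measure (integrable_continuousMap _ φ) (integrable_continuousMap ρ φ),
    integral_map (by fun_prop) φ.continuous.aestronglyMeasurable]

lemma integrable_integral_map_add (hΦ : Measurable Φ) (φ : C(X, ℝ)) :
    Integrable (fun b => ∫ x, φ x ∂(θ.map (fun s => Φ (s, b)) + ρ)) β := by
  have hint : Integrable (fun z => φ (Φ z)) (θ.prod β) :=
    (integrable_continuousMap ((θ.prod β).map Φ) φ).comp_measurable hΦ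
  simp only [integral_map_slice_add θ hΦ]
  exact hint.integral_prod_right.add (integrable_const (∫ x, φ x ∂ρ))

lemma integral_integral_map_add (hΦ : Measurable Φ) (φ : C(X, ℝ)) :
    ∫ b, ∫ x, φ x ∂(θ.map (fun s => Φ (s, b)) + ρ) ∂β = ∫ x, φ x ∂((θ.prod β).map Φ + ρ) := by
  have hint : Integrable (fun z => φ (Φ z)) (θ.prod β) :=
    (integrable_continuousMap ((θ.prod β).map Φ) φ).comp_measurable hΦ
  simp only [integral_map_slice_add θ hΦ]
  rw [integral_add hint.integral_prod_right (integrable_const _), ← integral_prod_symm _ hint,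
    integral_const, probReal_univ, one_smul,
    integral_add_measure (integrable_continuousMap _ φ) (integrable_continuousMap ρ φ),
    integral_map hΦ.aemeasurable φ.continuous.aestronglyMeasurable]

end CompactSpace

namespace DualCostLE

variable {c c' : X → Y → ℝ} {μ ρ : Measure X} {ν σ : Measure Y} {A B B' : ℝ}

lemma mono (h : DualCostLE c μ ν B) (hB : B ≤ B') : DualCostLE c μ ν B' :=
  fun φ ψ hφψ => (h φ ψ hφψ).trans hB

lemma mono_cost (h : DualCostLE c μ ν B) (hc : ∀ x y, c' x y ≤ c x y) : DualCostLE c' μ ν B :=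
  fun φ ψ hφψ => h φ ψ fun x y => (hφψ x y).trans (hc x y)

lemma flip (h : DualCostLE c μ ν B) : DualCostLE (Function.swap c) ν μ B := fun φ ψ hφψ => by
  rw [add_comm]
  exact h ψ φ fun x y => by rw [add_comm]; exact hφψ y x

lemma nonneg (h : DualCostLE c μ ν B) (hc : ∀ x y, 0 ≤ c x y) : 0 ≤ B := by
  simpa using h 0 0 fun x y => by simpa using hc x y

lemma exists_isLeast (h : DualCostLE c μ ν B) (hc : ∀ x y, 0 ≤ c x y) :
    ∃ s, IsLeast {s | DualCostLE c μ ν s} s :=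
  ⟨sInf {s | DualCostLE c μ ν s},
    fun φ ψ hφψ => le_csInf ⟨B, h⟩ fun _ hs => hs φ ψ hφψ,
    fun _ hs => csInf_le ⟨0, fun _ hs' => hs'.nonneg hc⟩ hs⟩

lemma smul_cost (h : DualCostLE c μ ν B) (hA : 0 < A) :
    DualCostLE (fun x y => A * c x y) μ ν (A * B) := fun φ ψ hφψ => by
  have h := h (A⁻¹ • φ) (A⁻¹ • ψ) fun x y => by
    simp only [ContinuousMap.smul_apply, smul_eq_mul, ← mul_add]
    exact (inv_mul_le_iff₀ hA).2 (hφψ x y)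
  simp only [ContinuousMap.smul_apply, smul_eq_mul, integral_const_mul, ← mul_add] at h
  exact (inv_mul_le_iff₀ hA).1 h

lemma smul_measure (h : DualCostLE c μ ν B) (a : ℝ≥0) :
    DualCostLE c (a • μ) (a • ν) (a * B) := fun φ ψ hφψ => by
  simp only [integral_smul_nnreal_measure, NNReal.smul_def, smul_eq_mul, ← mul_add]
  exact mul_le_mul_of_nonneg_left (h φ ψ hφψ) a.2

lemma of_map {S : Type*} [MeasurableSpace S] {θ : Measure S} [IsFiniteMeasure θ]
    [CompactSpace X] [OpensMeasurableSpace X] [CompactSpace Y] [OpensMeasurableSpace Y]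
    {f : S → X} {g : S → Y} (hf : Measurable f) (hg : Measurable g)
    (hc : Integrable (fun s => c (f s) (g s)) θ) :
    DualCostLE c (θ.map f) (θ.map g) (∫ s, c (f s) (g s) ∂θ) := fun φ ψ hφψ => by
  have hφ : Integrable (fun s => φ (f s)) θ :=
    (integrable_continuousMap (θ.map f) φ).comp_measurable hf
  have hψ : Integrable (fun s => ψ (g s)) θ :=
    (integrable_continuousMap (θ.map g) ψ).comp_measurable hg
  rw [integral_map hf.aemeasurable φ.continuous.aestronglyMeasurable,
    integral_map hg.aemeasurable ψ.continuous.aestronglyMeasurable, ← integral_add hφ hψ]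
  exact integral_mono (hφ.add hψ) hc fun s => hφψ _ _

lemma map {X' Y' : Type*} [TopologicalSpace X'] [MeasurableSpace X'] [BorelSpace X']
    [TopologicalSpace Y'] [MeasurableSpace Y'] [BorelSpace Y'] [OpensMeasurableSpace X]
    [OpensMeasurableSpace Y] {c : X' → Y' → ℝ} (f : C(X, X')) (g : C(Y, Y'))
    (h : DualCostLE (fun x y => c (f x) (g y)) μ ν B) : DualCostLE c (μ.map f) (ν.map g) B :=
  fun φ ψ hφψ => by
    rw [integral_map f.continuous.measurable.aemeasurable φ.continuous.aestronglyMeasurable,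
      integral_map g.continuous.measurable.aemeasurable ψ.continuous.aestronglyMeasurable]
    exact h (φ.comp f) (ψ.comp g) fun x y => hφψ (f x) (g y)

-- The intermediate potential is the `c₁`-transform `χ z = inf x, (c₁ x z - φ x)`.
lemma trans [CompactSpace X] [Nonempty X] {c₁ : X → Z → ℝ} {c₂ : Z → Y → ℝ} {η : Measure Z}
    {s t : ℝ} (hc₁ : Continuous (Function.uncurry c₁)) (hc : ∀ x y z, c x y ≤ c₁ x z + c₂ z y)
    (h₁ : DualCostLE c₁ μ η s) (h₂ : DualCostLE c₂ η ν t) : DualCostLE c μ ν (s + t) := by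
  intro φ ψ hφψ
  have hcont : Continuous fun q : Z × X => c₁ q.2 q.1 - φ q.2 :=
    (hc₁.comp continuous_swap).sub (φ.continuous.comp continuous_snd)
  let χ : C(Z, ℝ) := ⟨fun z => sInf ((fun x => c₁ x z - φ x) '' Set.univ),
    isCompact_univ.continuous_sInf hcont⟩
  have hbdd (z : Z) : BddBelow ((fun x => c₁ x z - φ x) '' Set.univ) :=
    (isCompact_univ.image (hcont.comp (Continuous.prodMk_right z))).bddBelow
  have hφχ (x : X) (z : Z) : φ x + χ z ≤ c₁ x z :=
    le_sub_iff_add_le'.1 (csInf_le (hbdd z) ⟨x, trivial, rfl⟩)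
  have hχψ (z : Z) (y : Y) : (-χ) z + ψ y ≤ c₂ z y := by
    rw [ContinuousMap.neg_apply, neg_add_le_iff_le_add, ← sub_le_iff_le_add]
    refine le_csInf (Set.univ_nonempty.image _) ?_
    rintro _ ⟨x, -, rfl⟩
    dsimp only
    linarith [hφψ x y, hc x y z]
  have e₁ := h₁ φ χ hφχ
  have e₂ := h₂ (-χ) ψ hχψ
  simp only [ContinuousMap.neg_apply, integral_neg] at e₂
  linarith

section Compact

variable [CompactSpace X] [OpensMeasurableSpace X]

lemma add [CompactSpace Y] [OpensMeasurableSpace Y] [IsFiniteMeasure μ] [IsFiniteMeasure ν]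
    [IsFiniteMeasure ρ] [IsFiniteMeasure σ] (h : DualCostLE c μ ν B) (h' : DualCostLE c ρ σ B') :
    DualCostLE c (μ + ρ) (ν + σ) (B + B') := fun φ ψ hφψ => by
  rw [integral_add_measure (integrable_continuousMap μ φ) (integrable_continuousMap ρ φ),
    integral_add_measure (integrable_continuousMap ν ψ) (integrable_continuousMap σ ψ)]
  linarith [h φ ψ hφψ, h' φ ψ hφψ]

lemma refl {c : X → X → ℝ} (hc : ∀ x, c x x ≤ 0) (μ : Measure X) [IsFiniteMeasure μ] :
    DualCostLE c μ μ 0 := fun φ ψ hφψ => by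
  rw [← integral_add (integrable_continuousMap μ φ) (integrable_continuousMap μ ψ)]
  exact integral_nonpos fun x => (hφψ x x).trans (hc x)

lemma add_common {c : X → X → ℝ} (hc : ∀ x, c x x ≤ 0) {ρ σ α β : Measure X} [IsFiniteMeasure σ]
    [IsFiniteMeasure α] [IsFiniteMeasure β] (hρ : ρ ≤ σ) (h : DualCostLE c (ρ + α) (ρ + β) B) :
    DualCostLE c (σ + α) (σ + β) B := by
  have : IsFiniteMeasure ρ := isFiniteMeasure_of_le σ hρ
  rw [← Measure.sub_add_cancel_of_le hρ, add_assoc, add_assoc]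
  simpa only [zero_add] using (refl hc (σ - ρ)).add h

section CompactTarget

variable [CompactSpace Y] [OpensMeasurableSpace Y]

lemma of_cost_le [IsProbabilityMeasure μ] [IsProbabilityMeasure ν] (hc : ∀ x y, c x y ≤ B) :
    DualCostLE c μ ν B := fun φ ψ hφψ => by
  have hφ (y : Y) : ∫ x, φ x ∂μ ≤ B - ψ y := by
    have h := integral_mono (integrable_continuousMap μ φ) (integrable_const (B - ψ y))
      fun x => le_sub_iff_add_le.2 ((hφψ x y).trans (hc x y))
    simpa using h
  have hψ := integral_mono (integrable_continuousMap ν ψ) (integrable_const (B - ∫ x, φ x ∂μ))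
    fun y => le_sub_comm.1 (hφ y)
  rw [integral_const, probReal_univ, one_smul] at hψ
  exact le_sub_iff_add_le'.1 hψ

lemma of_add_self [IsFiniteMeasure μ] [IsFiniteMeasure ν]
    (h : DualCostLE c (μ + μ) (ν + ν) (B + B)) : DualCostLE c μ ν B := fun φ ψ hφψ => by
  have h := h φ ψ hφψ
  rw [integral_add_measure (integrable_continuousMap μ φ) (integrable_continuousMap μ φ),
    integral_add_measure (integrable_continuousMap ν ψ) (integrable_continuousMap ν ψ)] at h
  linarith

-- Both dual integrals grow most when `P` and `Q` sit at maximum points of `φ` and `ψ`.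
lemma add_of_forall_dirac [IsFiniteMeasure μ] [IsFiniteMeasure ν] {P : Measure X} {Q : Measure Y}
    [IsFiniteMeasure P] [IsFiniteMeasure Q] {S : Set X} {T : Set Y} (hS : IsCompact S)
    (hS₀ : S.Nonempty) (hT : IsCompact T) (hT₀ : T.Nonempty) (hPS : S ∈ ae P) (hQT : T ∈ ae Q)
    (hPQ : P.real Set.univ = Q.real Set.univ) {e : ℝ≥0} (hPe : P.real Set.univ ≤ e)
    (h₀ : DualCostLE c μ ν B)
    (h : ∀ x ∈ S, ∀ y ∈ T, DualCostLE c (μ + e • Measure.dirac x) (ν + e • Measure.dirac y) B) :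
    DualCostLE c (μ + P) (ν + Q) B := fun φ ψ hφψ => by
  obtain ⟨x, hx, hmax⟩ := hS.exists_isMaxOn hS₀ φ.continuous.continuousOn
  obtain ⟨y, hy, hmay⟩ := hT.exists_isMaxOn hT₀ ψ.continuous.continuousOn
  have hφP := integral_le_of_forall_mem φ hPS hmax
  have hψQ := integral_le_of_forall_mem ψ hQT hmay
  have hbase := h₀ φ ψ hφψ
  have hdirac := h x hx y hy φ ψ hφψ
  rw [integral_add_measure (integrable_continuousMap μ φ) (integrable_continuousMap _ φ),
    integral_add_measure (integrable_continuousMap ν ψ) (integrable_continuousMap _ ψ)] at hdirac ⊢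
  rw [integral_smul_nnreal_measure, integral_smul_nnreal_measure,
    integral_dirac' _ _ φ.continuous.stronglyMeasurable,
    integral_dirac' _ _ ψ.continuous.stronglyMeasurable, NNReal.smul_def, NNReal.smul_def,
    smul_eq_mul, smul_eq_mul] at hdirac
  rw [← hPQ] at hψQ
  have hm : 0 ≤ P.real Set.univ := measureReal_nonneg
  rcases le_total (φ x + ψ y) 0 with hneg | hpos
  · nlinarith
  · nlinarith [mul_le_mul_of_nonneg_right hPe hpos]

lemma prod_map_add_of_forall {S D : Type*} [MeasurableSpace S] [MeasurableSpace D] {θ : Measure S}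
    [IsFiniteMeasure θ] {β : Measure D} [IsProbabilityMeasure β] [IsFiniteMeasure ρ]
    [IsFiniteMeasure σ] {Φ : S × D → X} {Ψ : S × D → Y} (hΦ : Measurable Φ) (hΨ : Measurable Ψ)
    (h : ∀ b, DualCostLE c (θ.map (fun s => Φ (s, b)) + ρ) (θ.map (fun s => Ψ (s, b)) + σ) B) :
    DualCostLE c ((θ.prod β).map Φ + ρ) ((θ.prod β).map Ψ + σ) B := fun φ ψ hφψ => by
  have hφ := integrable_integral_map_add (ρ := ρ) θ β hΦ φ
  have hψ := integrable_integral_map_add (ρ := σ) θ β hΨ ψ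
  rw [← integral_integral_map_add θ β hΦ φ, ← integral_integral_map_add θ β hΨ ψ,
    ← integral_add hφ hψ]
  have h := integral_mono (hφ.add hψ) (integrable_const B) fun b => h b φ ψ hφψ
  simpa using h

end CompactTarget

end Compact

end DualCostLE

end Dual

section Kantorovich

lemma exists_measure_integral_eq {K : Type*} [TopologicalSpace K] [CompactSpace K] [T2Space K]
    [MeasurableSpace K] [BorelSpace K] (g : C(K, ℝ) →ₗ[ℝ] ℝ) (hg : ∀ F, 0 ≤ F → 0 ≤ g F) :
    ∃ π : Measure K, IsFiniteMeasure π ∧ ∀ F : C(K, ℝ), ∫ z, F z ∂π = g F := by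
  let Λ : CompactlySupportedContinuousMap K ℝ →ₚ[ℝ] ℝ := PositiveLinearMap.mk₀
    { toFun := fun F => g F.toContinuousMap
      map_add' := fun F G => by rw [← map_add]; rfl
      map_smul' := fun c F => by rw [RingHom.id_apply, ← map_smul]; rfl }
    fun F hF => hg _ hF
  exact ⟨RealRMK.rieszMeasure Λ, ⟨isCompact_univ.measure_lt_top⟩, fun F =>
    RealRMK.integral_rieszMeasure Λ (CompactlySupportedContinuousMap.continuousMapEquiv F)⟩

section Majorant

variable {X Y : Type*} [TopologicalSpace X] [MeasurableSpace X] [TopologicalSpace Y]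
  [MeasurableSpace Y]

/-- The infimum of `∫ φ dμ + ∫ ψ dν` over all continuous `φ`, `ψ` with `F ≤ φ ⊕ ψ`: the sublinear
functional that a coupling of `μ` and `ν` is dominated by. -/
noncomputable def majorantIntegral (μ : Measure X) (ν : Measure Y) (F : C(X × Y, ℝ)) : ℝ :=
  sInf {s | ∃ (φ : C(X, ℝ)) (ψ : C(Y, ℝ)), (∀ x y, F (x, y) ≤ φ x + ψ y) ∧
    ∫ x, φ x ∂μ + ∫ y, ψ y ∂ν = s}

variable [CompactSpace X] [CompactSpace Y] {μ : Measure X} {ν : Measure Y} {F G : C(X × Y, ℝ)}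

lemma le_majorantIntegral {B : ℝ} (h : ∀ (φ : C(X, ℝ)) (ψ : C(Y, ℝ)),
    (∀ x y, F (x, y) ≤ φ x + ψ y) → B ≤ ∫ x, φ x ∂μ + ∫ y, ψ y ∂ν) :
    B ≤ majorantIntegral μ ν F := by
  refine le_csInf ⟨_, ContinuousMap.const X ‖F‖, 0, fun x y => ?_, rfl⟩ ?_
  · simpa using (le_abs_self _).trans (F.norm_coe_le_norm (x, y))
  · rintro _ ⟨φ, ψ, hF, rfl⟩
    exact h φ ψ hF

variable [OpensMeasurableSpace X] [OpensMeasurableSpace Y] [IsProbabilityMeasure μ]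
  [IsProbabilityMeasure ν]

lemma majorantIntegral_le {φ : C(X, ℝ)} {ψ : C(Y, ℝ)} (hF : ∀ x y, F (x, y) ≤ φ x + ψ y) :
    majorantIntegral μ ν F ≤ ∫ x, φ x ∂μ + ∫ y, ψ y ∂ν := by
  refine csInf_le ⟨-‖F‖, ?_⟩ ⟨φ, ψ, hF, rfl⟩
  rintro _ ⟨φ, ψ, hF, rfl⟩
  have h : DualCostLE (fun x y => -F (x, y)) μ ν ‖F‖ :=
    .of_cost_le fun x y => (neg_le_abs _).trans (F.norm_coe_le_norm (x, y))
  have h := h (-φ) (-ψ) fun x y => by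
    simp only [ContinuousMap.neg_apply]
    linarith [hF x y]
  simp only [ContinuousMap.neg_apply, integral_neg] at h
  linarith

lemma majorantIntegral_smul_le {a : ℝ} (ha : 0 < a) (F : C(X × Y, ℝ)) :
    majorantIntegral μ ν (a • F) ≤ a * majorantIntegral μ ν F := by
  rw [← inv_mul_le_iff₀ ha]
  refine le_majorantIntegral fun φ ψ hF => ?_
  rw [inv_mul_le_iff₀ ha]
  refine (majorantIntegral_le (φ := a • φ) (ψ := a • ψ) fun x y => ?_).trans_eq ?_
  · simpa only [ContinuousMap.smul_apply, smul_eq_mul, ← mul_add] using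
      mul_le_mul_of_nonneg_left (hF x y) ha.le
  · simp only [ContinuousMap.smul_apply, smul_eq_mul, integral_const_mul, ← mul_add]

lemma majorantIntegral_smul {a : ℝ} (ha : 0 < a) (F : C(X × Y, ℝ)) :
    majorantIntegral μ ν (a • F) = a * majorantIntegral μ ν F := by
  refine (majorantIntegral_smul_le ha F).antisymm ?_
  have h := majorantIntegral_smul_le (μ := μ) (ν := ν) (inv_pos.2 ha) (a • F)
  rwa [inv_smul_smul₀ ha.ne', le_inv_mul_iff₀ ha] at h

lemma majorantIntegral_add_le (F G : C(X × Y, ℝ)) :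
    majorantIntegral μ ν (F + G) ≤ majorantIntegral μ ν F + majorantIntegral μ ν G := by
  rw [← sub_le_iff_le_add]
  refine le_majorantIntegral fun φ ψ hF => ?_
  rw [sub_le_comm]
  refine le_majorantIntegral fun φ' ψ' hG => ?_
  rw [sub_le_iff_le_add]
  refine (majorantIntegral_le (φ := φ' + φ) (ψ := ψ' + ψ) fun x y => ?_).trans_eq ?_
  · simp only [ContinuousMap.add_apply]
    linarith [hF x y, hG x y]
  · simp only [ContinuousMap.add_apply]
    rw [integral_add (integrable_continuousMap μ φ') (integrable_continuousMap μ φ),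
      integral_add (integrable_continuousMap ν ψ') (integrable_continuousMap ν ψ)]
    ring

lemma nonneg_of_le_majorantIntegral {g : C(X × Y, ℝ) →ₗ[ℝ] ℝ}
    (hg : ∀ F, g F ≤ majorantIntegral μ ν F) (hF : 0 ≤ F) : 0 ≤ g F := by
  have h := (hg (-F)).trans (majorantIntegral_le (φ := 0) (ψ := 0) fun x y => by
    simpa using hF (x, y))
  simpa using h

lemma apply_add_eq_of_le_majorantIntegral {g : C(X × Y, ℝ) →ₗ[ℝ] ℝ}
    (hg : ∀ F, g F ≤ majorantIntegral μ ν F) (φ : C(X, ℝ)) (ψ : C(Y, ℝ)) :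
    g (φ.comp .fst + ψ.comp .snd) = ∫ x, φ x ∂μ + ∫ y, ψ y ∂ν := by
  refine le_antisymm ((hg _).trans (majorantIntegral_le fun x y => le_rfl)) ?_
  have h := (hg (-(φ.comp .fst + ψ.comp .snd))).trans
    (majorantIntegral_le (φ := -φ) (ψ := -ψ) fun x y => (neg_add _ _).le)
  simp only [map_neg, ContinuousMap.neg_apply, integral_neg] at h
  linarith

end Majorant

variable {X Y : Type*} [MetricSpace X] [CompactSpace X] [MeasurableSpace X] [BorelSpace X]
  [MetricSpace Y] [CompactSpace Y] [MeasurableSpace Y] [BorelSpace Y]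

-- The coupling represents a functional below `majorantIntegral` that touches it at `-c`.
theorem DualCostLE.exists_coupling {c : C(X × Y, ℝ)} {μ : Measure X} {ν : Measure Y}
    [IsProbabilityMeasure μ] [IsProbabilityMeasure ν] {B : ℝ}
    (h : DualCostLE (fun x y => c (x, y)) μ ν B) :
    ∃ π : Measure (X × Y), IsFiniteMeasure π ∧ π.map Prod.fst = μ ∧ π.map Prod.snd = ν ∧
      ∫ z, c z ∂π ≤ B := by
  obtain ⟨g, hgc, hg⟩ := exists_linearMap_eq_of_sublinear
    (fun _ => majorantIntegral_smul (μ := μ) (ν := ν)) majorantIntegral_add_le (-c)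
  obtain ⟨π, hπ, hπg⟩ := exists_measure_integral_eq g fun _ => nonneg_of_le_majorantIntegral hg
  refine ⟨π, hπ, ext_of_forall_integral_eq_of_IsFiniteMeasure fun f => ?_,
    ext_of_forall_integral_eq_of_IsFiniteMeasure fun f => ?_, ?_⟩
  · rw [integral_map measurable_fst.aemeasurable f.continuous.aestronglyMeasurable]
    simpa [← hπg] using apply_add_eq_of_le_majorantIntegral hg f.toContinuousMap 0
  · rw [integral_map measurable_snd.aemeasurable f.continuous.aestronglyMeasurable]
    simpa [← hπg] using apply_add_eq_of_le_majorantIntegral hg 0 f.toContinuousMap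
  · have hB : -B ≤ majorantIntegral μ ν (-c) := le_majorantIntegral fun φ ψ hφψ => by
      have h := h (-φ) (-ψ) fun x y => by
        have h := hφψ x y
        simp only [ContinuousMap.neg_apply] at h ⊢
        linarith
      simp only [ContinuousMap.neg_apply, integral_neg] at h
      linarith
    rw [← hgc, map_neg] at hB
    rw [hπg]
    exact neg_le_neg_iff.1 hB

end Kantorovich

section DistRpow

lemma add_rpow_le_weighted {p l u v : ℝ} (hp : 1 ≤ p) (hl : 0 < l) (hl1 : l < 1) (hu : 0 ≤ u)
    (hv : 0 ≤ v) : (u + v) ^ p ≤ l ^ (1 - p) * u ^ p + (1 - l) ^ (1 - p) * v ^ p := by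
  have hl' : 0 < 1 - l := sub_pos.2 hl1
  calc (u + v) ^ p = (l * (u / l) + (1 - l) * (v / (1 - l))) ^ p := by
        rw [mul_div_cancel₀ _ hl.ne', mul_div_cancel₀ _ hl'.ne']
    _ ≤ l * (u / l) ^ p + (1 - l) * (v / (1 - l)) ^ p :=
        (convexOn_rpow hp).2 (div_nonneg hu hl.le) (div_nonneg hv hl'.le) hl.le hl'.le (by ring)
    _ = l ^ (1 - p) * u ^ p + (1 - l) ^ (1 - p) * v ^ p := by
        rw [Real.div_rpow hu hl.le, Real.div_rpow hv hl'.le, Real.rpow_sub hl, Real.rpow_sub hl',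
          Real.rpow_one, Real.rpow_one]
        ring

lemma dist_rpow_le_weighted {X : Type*} [PseudoMetricSpace X] {p l : ℝ} (hp : 1 ≤ p) (hl : 0 < l)
    (hl1 : l < 1) (x y z : X) :
    dist x y ^ p ≤ l ^ (1 - p) * dist x z ^ p + (1 - l) ^ (1 - p) * dist z y ^ p :=
  (Real.rpow_le_rpow dist_nonneg (dist_triangle x z y) (zero_le_one.trans hp)).trans
    (add_rpow_le_weighted hp hl hl1 dist_nonneg dist_nonneg)

/-- A bound for the dual Kantorovich problem with the Wasserstein cost `dist x y ^ p`. -/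
abbrev DistRpowCostLE {X : Type*} [PseudoMetricSpace X] [MeasurableSpace X] (p : ℝ)
    (μ ν : Measure X) (B : ℝ) : Prop :=
  DualCostLE (fun x y => dist x y ^ p) μ ν B

namespace DistRpowCostLE

variable {X : Type*} [PseudoMetricSpace X] [MeasurableSpace X] {p B s t : ℝ} {μ ν : Measure X}

lemma nonneg (h : DistRpowCostLE p μ ν B) : 0 ≤ B :=
  DualCostLE.nonneg h fun _ _ => Real.rpow_nonneg dist_nonneg p

lemma symm (h : DistRpowCostLE p μ ν B) : DistRpowCostLE p ν μ B :=
  h.flip.mono_cost fun x y => by rw [Function.swap, dist_comm]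

lemma refl [CompactSpace X] [OpensMeasurableSpace X] (hp : 0 < p) (μ : Measure X)
    [IsFiniteMeasure μ] : DistRpowCostLE p μ μ 0 :=
  DualCostLE.refl (fun x => by rw [dist_self, Real.zero_rpow hp.ne']) μ

lemma of_diam [CompactSpace X] [OpensMeasurableSpace X] [IsProbabilityMeasure μ]
    [IsProbabilityMeasure ν] (hp : 0 ≤ p) :
    DistRpowCostLE p μ ν (Metric.diam (Set.univ : Set X) ^ p) :=
  .of_cost_le fun _ _ => Real.rpow_le_rpow dist_nonneg
    (Metric.dist_le_diam_of_mem isCompact_univ.isBounded trivial trivial) hp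

lemma add_common [CompactSpace X] [OpensMeasurableSpace X] (hp : 0 < p) {ρ σ α β : Measure X}
    [IsFiniteMeasure σ] [IsFiniteMeasure α] [IsFiniteMeasure β] (hρ : ρ ≤ σ)
    (h : DistRpowCostLE p (ρ + α) (ρ + β) B) : DistRpowCostLE p (σ + α) (σ + β) B :=
  DualCostLE.add_common (fun x => by rw [dist_self, Real.zero_rpow hp.ne']) hρ h

lemma trans [CompactSpace X] [Nonempty X] {l : ℝ} (hp : 1 ≤ p) (hl : 0 < l) (hl1 : l < 1)
    {η : Measure X} (h₁ : DistRpowCostLE p μ η s) (h₂ : DistRpowCostLE p η ν t) :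
    DistRpowCostLE p μ ν (l ^ (1 - p) * s + (1 - l) ^ (1 - p) * t) := by
  have : 0 < 1 - l := sub_pos.2 hl1
  have hcont : Continuous fun z : X × X => l ^ (1 - p) * dist z.1 z.2 ^ p :=
    (continuous_dist.rpow_const fun _ => .inr (zero_le_one.trans hp)).const_mul _
  exact DualCostLE.trans hcont (dist_rpow_le_weighted hp hl hl1)
    (h₁.smul_cost (by positivity)) (h₂.smul_cost (by positivity))

lemma chain [CompactSpace X] [OpensMeasurableSpace X] [Nonempty X] (hp : 1 ≤ p) (ht : 0 ≤ t)
    (n : ℕ) (ν : Fin (n + 1) → Measure X) [∀ j, IsFiniteMeasure (ν j)]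
    (h : ∀ j : Fin n, DistRpowCostLE p (ν j.castSucc) (ν j.succ) t) :
    DistRpowCostLE p (ν 0) (ν (Fin.last n)) ((2 * (1 / 2) ^ (1 - p)) ^ n * t) := by
  induction n with
  | zero => exact (refl (one_pos.trans_le hp) (ν 0)).mono (by simpa using ht)
  | succ n ih =>
    have hinit := ih (fun j => ν j.castSucc) fun j => h j.castSucc
    refine (hinit.trans hp one_half_pos one_half_lt_one (h (Fin.last n))).mono ?_
    have hA : 1 ≤ (1 / 2 : ℝ) ^ (1 - p) :=
      Real.one_le_rpow_of_pos_of_le_one_of_nonpos one_half_pos one_half_lt_one.le (sub_nonpos.2 hp)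
    have hAn : 1 ≤ (2 * (1 / 2 : ℝ) ^ (1 - p)) ^ n := one_le_pow₀ (by linarith)
    rw [sub_half, pow_succ]
    nlinarith [mul_nonneg (sub_nonneg.2 hAn) (mul_nonneg (zero_le_one.trans hA) ht)]

-- If `s` is the optimal bound, carrying the remaining copy of `μ` to `ν` costs `s` again, and `l`
-- is chosen so that `2 s ≤ l ^ (1 - p) B + 3 / 2 s`.
lemma exists_of_midpoint (X : Type*) [PseudoMetricSpace X] [MeasurableSpace X] [CompactSpace X]
    [OpensMeasurableSpace X] (hp : 1 < p) :
    ∃ A : ℝ, 0 < A ∧ ∀ (μ ν : Measure X) [IsProbabilityMeasure μ] [IsProbabilityMeasure ν] (B : ℝ),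
      DistRpowCostLE p (μ + μ) (μ + ν) B → DistRpowCostLE p μ ν (A * B) := by
  have hp' : 1 - p < 0 := by linarith
  have hlt : (3 / 2 : ℝ) ^ (1 / (1 - p)) < 1 :=
    Real.rpow_lt_one_of_one_lt_of_neg (by norm_num) (one_div_neg.2 hp')
  have hpos : 0 < (3 / 2 : ℝ) ^ (1 / (1 - p)) := by positivity
  set l : ℝ := 1 - (3 / 2 : ℝ) ^ (1 / (1 - p)) with hl
  have hl0 : 0 < l := sub_pos.2 hlt
  have hl' : (1 - l) ^ (1 - p) = 3 / 2 := by
    rw [hl, sub_sub_cancel, ← Real.rpow_mul (by norm_num), one_div_mul_cancel hp'.ne, Real.rpow_one]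
  refine ⟨2 * l ^ (1 - p), by positivity, fun μ ν _ _ B h => ?_⟩
  have : Nonempty X := μ.nonempty_of_neZero
  obtain ⟨s, hs, hmin⟩ := (of_diam (μ := μ) (ν := ν) (zero_le_one.trans hp.le)).exists_isLeast
    fun _ _ => Real.rpow_nonneg dist_nonneg p
  have hrest : DistRpowCostLE p (μ + ν) (ν + ν) s := by
    simpa using DualCostLE.add hs (refl (by linarith) ν)
  have htotal : DistRpowCostLE p (μ + μ) (ν + ν) (l ^ (1 - p) * B + 3 / 2 * s) := by
    simpa only [hl'] using h.trans hp.le hl0 (by linarith) hrest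
  have hhalf : DistRpowCostLE p μ ν ((l ^ (1 - p) * B + 3 / 2 * s) / 2) :=
    .of_add_self (by rwa [add_halves])
  exact DualCostLE.mono hs (by linarith [hmin hhalf])

theorem wasserstein_le {X : Type*} [MetricSpace X] [MeasurableSpace X] [CompactSpace X]
    [BorelSpace X] {μ ν : ProbabilityMeasure X} (hp : 0 < p)
    (h : DistRpowCostLE p (μ : Measure X) ν B) :
    wasserstein p μ ν ≤ ENNReal.ofReal (B ^ (1 / p)) := by
  let c : C(X × X, ℝ) :=
    ⟨fun z => dist z.1 z.2 ^ p, continuous_dist.rpow_const fun _ => .inr hp.le⟩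
  obtain ⟨π, hπ, hfst, hsnd, hcost⟩ := DualCostLE.exists_coupling (c := c) h
  have hlintegral : ∫⁻ z, edist z.1 z.2 ^ p ∂π ≤ ENNReal.ofReal B := by
    simp_rw [edist_dist, ENNReal.ofReal_rpow_of_nonneg dist_nonneg hp.le]
    exact (ofReal_integral_eq_lintegral_ofReal (integrable_continuousMap π c)
      (.of_forall fun z => Real.rpow_nonneg dist_nonneg p)).symm.trans_le
        (ENNReal.ofReal_le_ofReal hcost)
  rw [← ENNReal.ofReal_rpow_of_nonneg h.nonneg (by positivity)]
  exact ENNReal.rpow_le_rpow ((iInf₂_le π ⟨hfst, hsnd⟩).trans hlintegral) (by positivity)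

end DistRpowCostLE

end DistRpow

/-! ### Shifting mass across an interval -/

section Interval

open Set

lemma map_restrict_union_of_eqOn_const {S X : Type*} [MeasurableSpace S] [MeasurableSpace X]
    {μ : Measure S} {s t : Set S} (hst : Disjoint s t) (ht : MeasurableSet t) {G : S → X}
    (hG : Measurable G) {x : X} (hx : ∀ v ∈ t, G v = x) :
    (μ.restrict (s ∪ t)).map G = (μ.restrict s).map G + μ t • Measure.dirac x := by
  rw [Measure.restrict_union hst ht, Measure.map_add _ _ hG,
    Measure.map_congr ((ae_restrict_iff' ht).2 (.of_forall hx)), Measure.map_const,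
    Measure.restrict_apply_univ]

lemma map_restrict_Ioc_sub {X : Type*} [MeasurableSpace X] {G : ℝ → X} (hG : Measurable G)
    (a b e : ℝ) : ((volume.restrict (Ioc (a + e) (b + e))).map fun v => G (v - e)) =
      (volume.restrict (Ioc a b)).map G := by
  have h := (measurePreserving_sub_right (volume : Measure ℝ) e).restrict_preimage
    (measurableSet_Ioc (a := a) (b := b))
  rw [preimage_sub_const_Ioc] at h
  rw [← h.map_eq, Measure.map_map hG h.measurable]
  rfl

variable {a v e p : ℝ}

lemma rpow_sub_rpow_sub_le (he : 0 ≤ e) (hev : e ≤ v) (hv : 0 < v) (ha : 0 < a) :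
    v ^ a - (v - e) ^ a ≤ max 1 a * e * v ^ (a - 1) := by
  set x := e / v with hx
  have hx0 : 0 ≤ x := by positivity
  have hx1 : x ≤ 1 := (div_le_one hv).2 hev
  have bernoulli : 1 - max 1 a * x ≤ (1 - x) ^ a := by
    rcases le_total 1 a with h | h
    · rw [max_eq_right h]
      simpa [← sub_eq_add_neg] using one_add_mul_self_le_rpow_one_add (s := -x) (by linarith) h
    · rw [max_eq_left h, one_mul]
      simpa using Real.rpow_le_rpow_of_exponent_ge' (by linarith : 0 ≤ 1 - x) (by linarith) ha.le h
  calc v ^ a - (v - e) ^ a = v ^ a - v ^ a * (1 - x) ^ a := by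
        rw [← Real.mul_rpow hv.le (by linarith), hx, mul_sub, mul_one, mul_div_cancel₀ e hv.ne']
    _ ≤ v ^ a * (max 1 a * x) := by
        nlinarith [mul_le_mul_of_nonneg_left bernoulli (Real.rpow_nonneg hv.le a)]
    _ = max 1 a * e * v ^ (a - 1) := by
        rw [Real.rpow_sub hv, Real.rpow_one, hx]
        ring

/-- The quantile function of the density proportional to `s ^ (1 / a - 1)` on `[0, 1 / 2]`, extended
by constants to the whole line. The outer projection is inert for `0 ≤ a`. -/
noncomputable def halfPower (a v : ℝ) : unitInterval :=
  projIcc 0 1 zero_le_one (max 0 (min v 1) ^ a / 2)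

lemma coe_halfPower (ha : 0 ≤ a) : (halfPower a v : ℝ) = max 0 (min v 1) ^ a / 2 := by
  have h0 : 0 ≤ max 0 (min v 1) := le_max_left _ _
  have h1 : max 0 (min v 1) ^ a ≤ 1 :=
    Real.rpow_le_one h0 (max_le zero_le_one (min_le_right _ _)) ha
  rw [halfPower, projIcc_of_mem zero_le_one ⟨by positivity, by linarith⟩]

lemma coe_halfPower_of_mem (ha : 0 ≤ a) (hv : v ∈ Icc 0 1) : (halfPower a v : ℝ) = v ^ a / 2 := by
  rw [coe_halfPower ha, min_eq_left hv.2, max_eq_right hv.1]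

lemma continuous_halfPower (ha : 0 ≤ a) : Continuous (halfPower a) :=
  continuous_projIcc.comp
    (((continuous_const.max (continuous_id.min continuous_const)).rpow_const
      fun _ => Or.inr ha).div_const 2)

lemma halfPower_of_nonpos (ha : 0 < a) (hv : v ≤ 0) : halfPower a v = 0 := by
  rw [halfPower, max_eq_left (min_le_of_left_le hv), Real.zero_rpow ha.ne', zero_div]
  exact projIcc_left _

lemma halfPower_of_one_le (hv : 1 ≤ v) : halfPower a v = halfPower a 1 := by
  rw [halfPower, halfPower, min_eq_right hv, min_self]

lemma symm_halfPower_one (ha : 0 ≤ a) : unitInterval.symm (halfPower a 1) = halfPower a 1 := by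
  ext
  rw [unitInterval.coe_symm_eq, coe_halfPower_of_mem ha (right_mem_Icc.2 zero_le_one),
    Real.one_rpow]
  norm_num

lemma dist_halfPower_sub_le (ha : 0 < a) (he : 0 < e) (hv : v ∈ Icc e (1 + e)) :
    dist (halfPower a (v - e)) (halfPower a v) ≤ max 1 a * e * v ^ (a - 1) := by
  have hv0 : 0 < v := he.trans_le hv.1
  have hve : 0 ≤ v - e := sub_nonneg.2 hv.1
  have hmin : v - e ≤ min v 1 := le_min (by linarith) (by linarith [hv.2])
  have hmono : (v - e) ^ a ≤ min v 1 ^ a := Real.rpow_le_rpow hve hmin ha.le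
  have hle : min v 1 ^ a ≤ v ^ a :=
    Real.rpow_le_rpow (hve.trans hmin) (min_le_left _ _) ha.le
  rw [Subtype.dist_eq, coe_halfPower_of_mem ha.le ⟨hve, by linarith [hv.2]⟩, coe_halfPower ha.le,
    max_eq_right (hve.trans hmin), dist_comm, Real.dist_eq, ← sub_div,
    abs_of_nonneg (div_nonneg (sub_nonneg.2 hmono) zero_le_two)]
  linarith [rpow_sub_rpow_sub_le he.le hv.1 hv0 ha]

lemma dist_halfPower_zero_le (ha : 0 < a) (hv : v ∈ Icc 0 e) :
    dist (halfPower a (v - e)) (halfPower a v) ≤ e ^ a := by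
  have hmin : 0 ≤ min v 1 := le_min hv.1 zero_le_one
  have hle : min v 1 ^ a ≤ e ^ a :=
    Real.rpow_le_rpow hmin ((min_le_left _ _).trans hv.2) ha.le
  have h0 : 0 ≤ min v 1 ^ a := Real.rpow_nonneg hmin a
  rw [halfPower_of_nonpos ha (sub_nonpos.2 hv.2), Subtype.dist_eq, coe_halfPower ha.le,
    max_eq_right hmin, dist_comm, Real.dist_eq, Icc.coe_zero, sub_zero,
    abs_of_nonneg (by positivity)]
  linarith

/-- The order of the cost of shifting mass `e` across the density `s ^ (1 / a - 1)`. -/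
noncomputable def shiftCost (p a e : ℝ) : ℝ :=
  e ^ (1 + a * p) + e ^ p * ∫ v in e..(1 + e), v ^ ((a - 1) * p)

lemma shiftCost_nonneg (he : 0 ≤ e) : 0 ≤ shiftCost p a e :=
  add_nonneg (by positivity) (mul_nonneg (by positivity)
    (intervalIntegral.integral_nonneg (by linarith) fun _ hv => Real.rpow_nonneg (he.trans hv.1) _))

lemma continuous_dist_halfPower_rpow (ha : 0 ≤ a) (hp : 0 ≤ p) :
    Continuous fun v => dist (halfPower a (v - e)) (halfPower a v) ^ p :=
  (((continuous_halfPower ha).comp (continuous_id.sub continuous_const)).dist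
    (continuous_halfPower ha)).rpow_const fun _ => Or.inr hp

lemma integral_dist_halfPower_zero_le (ha : 0 < a) (he : 0 < e) (hp : 0 ≤ p) :
    ∫ v in (0 : ℝ)..e, dist (halfPower a (v - e)) (halfPower a v) ^ p ≤ e ^ (1 + a * p) := by
  calc _ ≤ ∫ _ in (0 : ℝ)..e, e ^ (a * p) := by
        refine intervalIntegral.integral_mono_on he.le
          ((continuous_dist_halfPower_rpow ha.le hp).intervalIntegrable _ _) (by simp)
          fun v hv => ?_
        rw [Real.rpow_mul he.le]
        exact Real.rpow_le_rpow dist_nonneg (dist_halfPower_zero_le ha hv) hp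
    _ = e ^ (1 + a * p) := by
        rw [intervalIntegral.integral_const, sub_zero, smul_eq_mul, Real.rpow_add he, Real.rpow_one]

lemma integral_dist_halfPower_sub_le (ha : 0 < a) (he : 0 < e) (hp : 0 ≤ p) :
    ∫ v in e..(1 + e), dist (halfPower a (v - e)) (halfPower a v) ^ p ≤
      max 1 a ^ p * (e ^ p * ∫ v in e..(1 + e), v ^ ((a - 1) * p)) := by
  rw [← mul_assoc, ← intervalIntegral.integral_const_mul]
  refine intervalIntegral.integral_mono_on (by linarith)
    ((continuous_dist_halfPower_rpow ha.le hp).intervalIntegrable _ _) ?_ fun v hv => ?_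
  · refine (intervalIntegral.intervalIntegrable_rpow (Or.inr ?_)).const_mul _
    rw [uIcc_of_le (by linarith)]
    exact fun h => absurd h.1 (not_le.2 he)
  · have hv0 : 0 < v := he.trans_le hv.1
    refine (Real.rpow_le_rpow dist_nonneg (dist_halfPower_sub_le ha he hv) hp).trans_eq ?_
    rw [Real.mul_rpow (by positivity) (by positivity), Real.mul_rpow (by positivity) he.le,
      ← Real.rpow_mul hv0.le]

lemma integral_dist_halfPower_le (ha : 0 < a) (he : 0 < e) (hp : 0 ≤ p) :
    ∫ v in (0 : ℝ)..(1 + e), dist (halfPower a (v - e)) (halfPower a v) ^ p ≤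
      max 1 a ^ p * shiftCost p a e := by
  have hc := continuous_dist_halfPower_rpow (e := e) ha.le hp
  rw [← intervalIntegral.integral_add_adjacent_intervals (hc.intervalIntegrable 0 e)
    (hc.intervalIntegrable e (1 + e)), shiftCost, mul_add]
  refine add_le_add ((integral_dist_halfPower_zero_le ha he hp).trans ?_)
    (integral_dist_halfPower_sub_le ha he hp)
  exact le_mul_of_one_le_left (by positivity) (Real.one_le_rpow (le_max_left _ _) hp)

/-- The distribution on `[0, 1 / 2]` with density proportional to `s ^ (1 / a - 1)`. -/
noncomputable def powerMeasure (a : ℝ) : Measure unitInterval :=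
  (volume.restrict (Ioc 0 1)).map (halfPower a)

lemma map_halfPower_sub {e : ℝ≥0} (ha : 0 < a) :
    ((volume.restrict (Ioc (0 : ℝ) (1 + e))).map fun v => halfPower a (v - e)) =
      powerMeasure a + e • Measure.dirac 0 := by
  have hG := (continuous_halfPower ha.le).measurable
  rw [← neg_add_cancel (e : ℝ), map_restrict_Ioc_sub hG, ← Ioc_union_Ioc_eq_Ioc
    (neg_nonpos.2 e.coe_nonneg) zero_le_one, union_comm, map_restrict_union_of_eqOn_const
    (Ioc_disjoint_Ioc_of_le le_rfl).symm measurableSet_Ioc hG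
    fun v hv => halfPower_of_nonpos ha hv.2]
  rw [Real.volume_Ioc, sub_neg_eq_add, zero_add, ENNReal.ofReal_coe_nnreal]
  rfl

lemma map_halfPower {e : ℝ≥0} (ha : 0 < a) :
    (volume.restrict (Ioc (0 : ℝ) (1 + e))).map (halfPower a) =
      powerMeasure a + e • Measure.dirac (halfPower a 1) := by
  rw [← Ioc_union_Ioc_eq_Ioc zero_le_one (le_add_of_nonneg_right e.coe_nonneg),
    map_restrict_union_of_eqOn_const (Ioc_disjoint_Ioc_of_le le_rfl) measurableSet_Ioc
    (continuous_halfPower ha.le).measurable fun v hv => halfPower_of_one_le hv.1.le]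
  rw [Real.volume_Ioc, add_sub_cancel_left, ENNReal.ofReal_coe_nnreal]
  rfl

lemma distRpowCostLE_powerMeasure (ha : 0 < a) (hp : 0 ≤ p) {e : ℝ≥0} (he : 0 < e) :
    DistRpowCostLE p (powerMeasure a + e • Measure.dirac 0)
      (powerMeasure a + e • Measure.dirac (halfPower a 1)) (max 1 a ^ p * shiftCost p a e) := by
  have hG := continuous_halfPower ha.le
  rw [← map_halfPower_sub ha, ← map_halfPower ha]
  refine (DualCostLE.of_map (hG.comp (continuous_id.sub continuous_const)).measurable
    hG.measurable ?_).mono ?_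
  · exact ((continuous_dist_halfPower_rpow ha.le hp).integrableOn_Icc).mono_set Ioc_subset_Icc_self
  · rw [← intervalIntegral.integral_of_le (by positivity)]
    exact integral_dist_halfPower_le ha he hp

/-- The measure `K s ^ (d - 1) (1 - s) ^ (d - 1) ds` on `[0, 1]`. -/
noncomputable def betaWeight (d K : ℝ) : Measure unitInterval :=
  volume.withDensity fun s =>
    ENNReal.ofReal (K * (s : ℝ) ^ (d - 1) * (1 - (s : ℝ)) ^ (d - 1))

variable {d K : ℝ}

lemma measurable_betaDensity : Measurable fun s : unitInterval =>
    ENNReal.ofReal (K * (s : ℝ) ^ (d - 1) * (1 - (s : ℝ)) ^ (d - 1)) := by fun_prop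

lemma map_symm_betaWeight : (betaWeight d K).map unitInterval.symm = betaWeight d K := by
  ext E hE
  rw [Measure.map_apply unitInterval.measurable_symm hE, betaWeight,
    withDensity_apply _ (unitInterval.measurable_symm hE), withDensity_apply _ hE,
    ← unitInterval.measurePreserving_symm.setLIntegral_comp_preimage hE measurable_betaDensity]
  refine lintegral_congr fun s => ?_
  simp only [unitInterval.coe_symm_eq, sub_sub_cancel]
  congr 1
  ring

lemma betaWeight_apply {E : Set unitInterval} (hE : MeasurableSet E) :
    betaWeight d K E = ∫⁻ s in Icc (0 : ℝ) 1,
      ENNReal.ofReal (K * s ^ (d - 1) * (1 - s) ^ (d - 1)) *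
        E.indicator 1 (projIcc (0 : ℝ) 1 zero_le_one s) := by
  rw [betaWeight, withDensity_apply _ hE, ← lintegral_indicator hE,
    ← lintegral_subtype_comap measurableSet_Icc]
  refine lintegral_congr fun s => ?_
  by_cases hs : s ∈ E <;> simp [hs]

lemma image_two_mul_rpow (hd : 0 < d) :
    (fun s : ℝ => (2 * s) ^ d) '' Ioc 0 (1 / 2) = Ioc 0 1 := by
  ext v
  constructor
  · rintro ⟨s, ⟨hs0, hs⟩, rfl⟩
    exact ⟨by positivity, Real.rpow_le_one (by positivity) (by linarith) hd.le⟩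
  · rintro ⟨hv0, hv⟩
    refine ⟨v ^ d⁻¹ / 2, ⟨by positivity, ?_⟩, ?_⟩
    · linarith [Real.rpow_le_one hv0.le hv (inv_nonneg.2 hd.le)]
    · simp only [mul_div_cancel₀ _ (two_ne_zero' ℝ), Real.rpow_inv_rpow hv0.le hd.ne']

lemma hasDerivAt_two_mul_rpow {s : ℝ} (hs : 0 < s) :
    HasDerivAt (fun s : ℝ => (2 * s) ^ d) (d * 2 ^ d * s ^ (d - 1)) s := by
  convert ((hasDerivAt_id' s).const_mul 2).rpow_const (p := d) (Or.inl (by positivity)) using 1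
  rw [mul_one, Real.mul_rpow zero_le_two hs.le, Real.rpow_sub_one (two_ne_zero' ℝ)]
  ring

lemma halfPower_two_mul_rpow {s : ℝ} (hd : 0 < d) (hs : s ∈ Ioc 0 (1 / 2)) :
    halfPower (1 / d) ((2 * s) ^ d) = projIcc (0 : ℝ) 1 zero_le_one s := by
  have hmem := image_two_mul_rpow hd ▸ mem_image_of_mem (fun s : ℝ => (2 * s) ^ d) hs
  ext
  rw [coe_halfPower_of_mem (by positivity) (Ioc_subset_Icc_self hmem), one_div,
    Real.rpow_rpow_inv (by linarith [hs.1]) hd.ne', mul_div_cancel_left₀ _ two_ne_zero,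
    projIcc_of_mem zero_le_one ⟨hs.1.le, by linarith [hs.2]⟩]

lemma powerMeasure_apply (hd : 0 < d) {E : Set unitInterval} (hE : MeasurableSet E) :
    powerMeasure (1 / d) E = ∫⁻ s in Ioc (0 : ℝ) (1 / 2),
      ENNReal.ofReal (d * 2 ^ d * s ^ (d - 1)) *
        E.indicator 1 (projIcc (0 : ℝ) 1 zero_le_one s) := by
  have hG := (continuous_halfPower (one_div_nonneg.2 hd.le)).measurable
  have hinj : InjOn (fun s : ℝ => (2 * s) ^ d) (Ioc 0 (1 / 2)) := fun s hs t ht h =>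
    mul_left_cancel₀ two_ne_zero ((Real.rpow_left_inj (by linarith [hs.1]) (by linarith [ht.1])
      hd.ne').1 h)
  rw [powerMeasure, Measure.map_apply hG hE, ← lintegral_indicator_one (hG hE),
    ← image_two_mul_rpow hd, lintegral_image_eq_lintegral_abs_deriv_mul measurableSet_Ioc
      (fun s hs => (hasDerivAt_two_mul_rpow hs.1).hasDerivWithinAt) hinj]
  refine setLIntegral_congr_fun measurableSet_Ioc fun s hs => ?_
  have hs0 : 0 < s := hs.1
  simp only [← halfPower_two_mul_rpow hd hs]
  rw [abs_of_nonneg (by positivity)]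
  rfl

lemma min_one_le_one_sub_rpow {s : ℝ} (hs : 0 ≤ s) (hs' : s ≤ 1 / 2) :
    min 1 ((1 / 2 : ℝ) ^ (d - 1)) ≤ (1 - s) ^ (d - 1) := by
  rcases le_total 0 (d - 1) with h | h
  · exact (min_le_right _ _).trans (Real.rpow_le_rpow (by norm_num) (by linarith) h)
  · refine (min_le_left _ _).trans ?_
    exact Real.one_le_rpow_of_pos_of_le_one_of_nonpos (by linarith) (by linarith) h

lemma exists_smul_powerMeasure_le_betaWeight (hd : 0 < d) (hK : 0 < K) :
    ∃ κ : ℝ≥0, 0 < κ ∧ κ • powerMeasure (1 / d) ≤ betaWeight d K := by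
  let κ : ℝ≥0 := ⟨K * min 1 ((1 / 2 : ℝ) ^ (d - 1)) / (d * 2 ^ d), by positivity⟩
  have hκ : (κ : ℝ) * (d * 2 ^ d) = K * min 1 ((1 / 2 : ℝ) ^ (d - 1)) :=
    div_mul_cancel₀ _ (by positivity)
  refine ⟨κ, NNReal.coe_pos.1 (div_pos (by positivity) (by positivity)),
    Measure.le_iff.2 fun E hE => ?_⟩
  rw [Measure.smul_apply, ENNReal.smul_def, smul_eq_mul, powerMeasure_apply hd hE,
    betaWeight_apply hE, ← lintegral_const_mul' _ _ ENNReal.coe_ne_top]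
  refine (setLIntegral_mono' measurableSet_Ioc fun s hs => ?_).trans
    (lintegral_mono_set (Ioc_subset_Icc_self.trans (Icc_subset_Icc_right (by norm_num))))
  have hs0 : 0 ≤ s ^ (d - 1) := Real.rpow_nonneg hs.1.le _
  rw [← mul_assoc, ← ENNReal.ofReal_coe_nnreal, ← ENNReal.ofReal_mul κ.coe_nonneg]
  refine mul_le_mul_left (ENNReal.ofReal_le_ofReal ?_) _
  calc (κ : ℝ) * (d * 2 ^ d * s ^ (d - 1)) =
        K * s ^ (d - 1) * min 1 ((1 / 2 : ℝ) ^ (d - 1)) := by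
        rw [← mul_assoc, hκ]
        ring
    _ ≤ K * s ^ (d - 1) * (1 - s) ^ (d - 1) := by
        gcongr
        exact min_one_le_one_sub_rpow hs.1.le hs.2

lemma exists_distRpowCostLE_betaWeight_half (hd : 0 < d) (hK : 0 < K) (hp : 0 < p) :
    ∃ c C : ℝ, 0 < c ∧ 0 < C ∧ ∀ e : ℝ≥0, 0 < e → IsFiniteMeasure (betaWeight d K) →
      DistRpowCostLE p (betaWeight d K + e • Measure.dirac 0)
        (betaWeight d K + e • Measure.dirac (halfPower (1 / d) 1))
        (C * shiftCost p (1 / d) (c * e)) := by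
  obtain ⟨κ, hκ, hκβ⟩ := exists_smul_powerMeasure_le_betaWeight hd hK
  refine ⟨κ⁻¹, κ * max 1 (1 / d) ^ p, by positivity, by positivity, fun e he _ => ?_⟩
  have h := (distRpowCostLE_powerMeasure (one_div_pos.2 hd) hp.le
    (mul_pos (inv_pos.2 hκ) he)).smul_measure κ
  rw [smul_add, smul_add, smul_smul, smul_smul, mul_inv_cancel_left₀ hκ.ne', ← mul_assoc] at h
  exact DistRpowCostLE.add_common hp hκβ h

lemma exists_distRpowCostLE_betaWeight (hd : 0 < d) (hK : 0 < K) (hp : 1 ≤ p) :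
    ∃ c C : ℝ, 0 < c ∧ 0 < C ∧ ∀ e : ℝ≥0, 0 < e → IsFiniteMeasure (betaWeight d K) →
      DistRpowCostLE p (betaWeight d K + e • Measure.dirac 0)
        (betaWeight d K + e • Measure.dirac 1) (C * shiftCost p (1 / d) (c * e)) := by
  have hp0 : 0 < p := one_pos.trans_le hp
  obtain ⟨c, C, hc, hC, half⟩ := exists_distRpowCostLE_betaWeight_half hd hK hp0
  refine ⟨c, 2 * (1 / 2) ^ (1 - p) * C, hc, by positivity, fun e he hfin => ?_⟩
  have hsymm : DistRpowCostLE p (betaWeight d K + e • Measure.dirac (halfPower (1 / d) 1))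
      (betaWeight d K + e • Measure.dirac 1) (C * shiftCost p (1 / d) (c * e)) := by
    have h : DistRpowCostLE p _ _ _ := ((half e he hfin).mono_cost fun x y => (by
      rw [Subtype.dist_eq, Subtype.dist_eq, unitInterval.coe_symm_eq, unitInterval.coe_symm_eq,
        dist_sub_left] : dist (unitInterval.symm x) (unitInterval.symm y) ^ p ≤ _)).map
      ⟨_, unitInterval.continuous_symm⟩ ⟨_, unitInterval.continuous_symm⟩
    simpa only [ContinuousMap.coe_mk, Measure.map_add _ _ unitInterval.measurable_symm,
      map_symm_betaWeight, Measure.map_smul, Measure.map_dirac' unitInterval.measurable_symm,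
      unitInterval.symm_zero, symm_halfPower_one (one_div_nonneg.2 hd.le)] using h.symm
  refine ((half e he hfin).trans hp one_half_pos one_half_lt_one hsymm).mono (le_of_eq ?_)
  rw [sub_half]
  ring

end Interval

/-! ### Moving an atom within the support -/

section Connected

variable {X : Type*} [PseudoMetricSpace X] [MeasurableSpace X]
  {D : Type*} [MeasurableSpace D] {β : Measure D}
  {μ : ProbabilityMeasure X} {d K p t : ℝ} {e L : ℝ≥0} {y y' : X} {Φ : unitInterval × D → X}

lemma tubeMeasure_eq_prod [SFinite β] : tubeMeasure d K β = (betaWeight d K).prod β := by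
  rw [betaWeight, prod_withDensity_left measurable_betaDensity, tubeMeasure]

namespace IsTube

lemma distRpowCostLE_slice [BorelSpace X] (h : IsTube d L K β μ y y' Φ) (hL : 0 < L) (hp : 0 ≤ p)
    (ht : DistRpowCostLE p (betaWeight d K + e • Measure.dirac 0)
      (betaWeight d K + e • Measure.dirac 1) t) (b : D) :
    DistRpowCostLE p ((betaWeight d K).map (fun s => Φ (s, b)) + e • Measure.dirac y)
      ((betaWeight d K).map (fun s => Φ (s, b)) + e • Measure.dirac y') (L ^ p * t) := by
  have hc : Continuous fun s => Φ (s, b) := (h.lipschitz b).continuous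
  have hcost (s s' : unitInterval) : dist (Φ (s, b)) (Φ (s', b)) ^ p ≤ L ^ p * dist s s' ^ p := by
    rw [← Real.mul_rpow L.coe_nonneg dist_nonneg]
    exact Real.rpow_le_rpow dist_nonneg ((h.lipschitz b).dist_le_mul s s') hp
  have hmap : DistRpowCostLE p _ _ _ :=
    ((ht.smul_cost (A := (L : ℝ) ^ p) (by positivity)).mono_cost hcost).map ⟨_, hc⟩ ⟨_, hc⟩
  simpa only [ContinuousMap.coe_mk, Measure.map_add _ _ hc.measurable, Measure.map_smul,
    Measure.map_dirac' hc.measurable, h.source, h.target] using hmap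

variable [IsProbabilityMeasure β]

lemma isFiniteMeasure_betaWeight (h : IsTube d L K β μ y y' Φ) :
    IsFiniteMeasure (betaWeight d K) := by
  have hle := h.map_le Set.univ
  rw [Measure.map_apply h.measurable MeasurableSet.univ, Set.preimage_univ, tubeMeasure_eq_prod,
    ← Set.univ_prod_univ, Measure.prod_prod, measure_univ (μ := β), mul_one] at hle
  exact ⟨hle.trans_lt (measure_lt_top _ _)⟩

lemma distRpowCostLE [CompactSpace X] [BorelSpace X] (h : IsTube d L K β μ y y' Φ) (hL : 0 < L)
    (hp : 0 < p)
    (ht : DistRpowCostLE p (betaWeight d K + e • Measure.dirac 0)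
      (betaWeight d K + e • Measure.dirac 1) t) :
    DistRpowCostLE p ((μ : Measure X) + e • Measure.dirac y) (μ + e • Measure.dirac y')
      (L ^ p * t) := by
  have hfin := h.isFiniteMeasure_betaWeight
  refine DistRpowCostLE.add_common hp h.map_le ?_
  rw [tubeMeasure_eq_prod]
  exact .prod_map_add_of_forall h.measurable h.measurable (h.distRpowCostLE_slice hL hp.le ht)

end IsTube

lemma exists_distRpowCostLE_of_stronglyConnectedWith (X : Type*) [PseudoMetricSpace X]
    [CompactSpace X] [MeasurableSpace X] [BorelSpace X] (hd : 0 < d) (hK : 0 < K) (hL : 0 < L)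
    (N : ℕ) (hp : 1 ≤ p) :
    ∃ c C : ℝ, 0 < c ∧ 0 < C ∧ ∀ μ : ProbabilityMeasure X,
      StronglyConnectedWith.{v} d L K N μ → ∀ e : ℝ≥0, 0 < e → ∀ x₀ ∈ supp μ, ∀ x₁ ∈ supp μ,
        DistRpowCostLE p ((μ : Measure X) + e • Measure.dirac x₀) (μ + e • Measure.dirac x₁)
          (C * shiftCost p (1 / d) (c * e)) := by
  obtain ⟨c, C, hc, hC, hβ⟩ := exists_distRpowCostLE_betaWeight hd hK hp
  have hA : 1 ≤ 2 * (1 / 2 : ℝ) ^ (1 - p) := by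
    linarith [Real.one_le_rpow_of_pos_of_le_one_of_nonpos one_half_pos one_half_lt_one.le
      (sub_nonpos.2 hp)]
  refine ⟨c, (2 * (1 / 2) ^ (1 - p)) ^ N * (L ^ p * C), hc, by positivity, ?_⟩
  rintro μ ⟨D, _, β, _, hconn⟩ e he x₀ hx₀ x₁ hx₁
  obtain ⟨n, y, Φ, hn, rfl, rfl, -, hΦ⟩ := hconn x₀ hx₀ x₁ hx₁
  have : Nonempty X := ⟨y 0⟩
  have hR : 0 ≤ shiftCost p (1 / d) (c * e) := shiftCost_nonneg (by positivity)
  have htube (j : Fin n) := (hΦ j).distRpowCostLE hL (by linarith)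
    (hβ e he (hΦ j).isFiniteMeasure_betaWeight)
  refine (DistRpowCostLE.chain hp (by positivity) n
    (fun j => (μ : Measure X) + e • Measure.dirac (y j)) htube).mono ?_
  rw [← mul_assoc (L ^ p : ℝ), mul_assoc (_ ^ N : ℝ)]
  exact mul_le_mul_of_nonneg_right (pow_le_pow_right₀ hA (by omega)) (by positivity)

end Connected

section TotalVariation

variable {X : Type*} [MeasurableSpace X]

lemma add_sub_eq_add_sub_measure (μ ν : Measure X) [IsFiniteMeasure μ] [IsFiniteMeasure ν] :
    μ + (ν - μ) = ν + (μ - ν) := by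
  rw [← Measure.toSignedMeasure_eq_toSignedMeasure_iff, Measure.toSignedMeasure_add,
    Measure.toSignedMeasure_add, add_comm ν.toSignedMeasure, ← sub_eq_sub_iff_add_eq_add]
  exact Measure.sub_toSignedMeasure_eq_toSignedMeasure_sub

lemma tvDist_eq (μ ν : ProbabilityMeasure X) :
    tvDist μ ν = ((μ : Measure X) - ν).real Set.univ + ((ν : Measure X) - μ).real Set.univ := by
  rw [tvDist, SignedMeasure.totalVariation, Measure.toJordanDecomposition_toSignedMeasure_sub]
  exact ENNReal.toReal_add (measure_ne_top _ _) (measure_ne_top _ _)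

lemma real_sub_univ_comm (μ ν : ProbabilityMeasure X) :
    ((μ : Measure X) - ν).real Set.univ = ((ν : Measure X) - μ).real Set.univ := by
  have h := congrArg (fun ρ : Measure X => ρ.real Set.univ)
    (add_sub_eq_add_sub_measure (μ : Measure X) ν)
  rw [measureReal_add_apply, measureReal_add_apply, probReal_univ (μ := (μ : Measure X)),
    probReal_univ (μ := (ν : Measure X))] at h
  linarith

lemma real_sub_univ_le_tvDist (μ ν : ProbabilityMeasure X) :
    ((μ : Measure X) - ν).real Set.univ ≤ tvDist ν μ := by
  rw [tvDist_eq]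
  exact le_add_of_nonneg_left measureReal_nonneg

end TotalVariation

lemma DistRpowCostLE.add_self_add {X : Type*} [PseudoMetricSpace X] [CompactSpace X]
    [MeasurableSpace X] [BorelSpace X] {p t : ℝ} {e : ℝ≥0} (hp : 0 < p) {μ ν : ProbabilityMeasure X}
    (hsupp : supp ν ⊆ supp μ) (hle : tvDist ν μ ≤ e) (ht : 0 ≤ t)
    (h : ∀ x₀ ∈ supp μ, ∀ x₁ ∈ supp μ,
      DistRpowCostLE p ((μ : Measure X) + e • Measure.dirac x₀) (μ + e • Measure.dirac x₁) t) :
    DistRpowCostLE p ((μ : Measure X) + (μ : Measure X)) ((μ : Measure X) + (ν : Measure X))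
      t := by
  have hcompact : IsCompact (supp μ) := Measure.isClosed_support.isCompact
  have hne : (supp μ).Nonempty := Measure.nonempty_support (NeZero.ne _)
  set P := (μ : Measure X) - ν
  set Q := (ν : Measure X) - μ
  have hPμ : P ≤ μ := Measure.sub_le
  have hQν : Q ≤ ν := Measure.sub_le
  have hP : supp μ ∈ ae P := hPμ.absolutelyContinuous.ae_le Measure.support_mem_ae
  have hQ : supp μ ∈ ae Q :=
    Filter.mem_of_superset (hQν.absolutelyContinuous.ae_le Measure.support_mem_ae) hsupp
  have hμμ : DistRpowCostLE p (μ : Measure X) μ t := (DistRpowCostLE.refl hp _).mono ht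
  have hPQ : DistRpowCostLE p ((μ : Measure X) + P) (μ + Q) t :=
    DualCostLE.add_of_forall_dirac hcompact hne hcompact hne hP hQ (real_sub_univ_comm μ ν)
      ((real_sub_univ_le_tvDist μ ν).trans hle) hμμ h
  have hadd := DistRpowCostLE.add_common hp
    (Measure.le_add_right (ν' := (μ : Measure X) - P) (le_refl (μ : Measure X))) hPQ
  have hsource : (μ : Measure X) + (μ - P) + P = μ + μ := by
    rw [add_assoc, Measure.sub_add_cancel_of_le hPμ]
  have htarget : (μ : Measure X) + (μ - P) + Q = μ + ν := by
    rw [add_right_comm, add_sub_eq_add_sub_measure, add_assoc, add_comm P,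
      Measure.sub_add_cancel_of_le hPμ, add_comm]
  rwa [hsource, htarget] at hadd

/-! ### Rates -/

section Rates

variable {p a d e M x : ℝ}

lemma notMem_uIcc_add_one (he : 0 < e) : (0 : ℝ) ∉ Set.uIcc e (1 + e) := by
  rw [Set.uIcc_of_le (by linarith)]
  exact fun h => h.1.not_gt he

lemma shiftCost_le_of_lt (h : (a - 1) * p < -1) (he : 0 < e) :
    shiftCost p a e ≤ (1 + 1 / -((a - 1) * p + 1)) * e ^ (1 + a * p) := by
  set b := (a - 1) * p with hb
  have hexp : 1 + a * p = p + (b + 1) := by rw [hb]; ring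
  have hb1 : 0 < -(b + 1) := by linarith
  have hint : ((1 + e) ^ (b + 1) - e ^ (b + 1)) / (b + 1) ≤ e ^ (b + 1) * (1 / -(b + 1)) := by
    rw [← neg_div_neg_eq, div_eq_mul_one_div]
    refine mul_le_mul_of_nonneg_right ?_ (by positivity)
    linarith [Real.rpow_nonneg (by linarith : 0 ≤ 1 + e) (b + 1)]
  rw [shiftCost, ← hb, integral_rpow (Or.inr ⟨h.ne, notMem_uIcc_add_one he⟩)]
  calc _ ≤ e ^ (1 + a * p) + e ^ p * (e ^ (b + 1) * (1 / -(b + 1))) := by gcongr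
    _ = _ := by
      rw [← mul_assoc, ← Real.rpow_add he, ← hexp]
      ring

lemma shiftCost_le_of_gt (h : -1 < (a - 1) * p) (he : 0 < e) (heM : e ≤ M) :
    shiftCost p a e ≤
      (M ^ ((a - 1) * p + 1) + (1 + M) ^ ((a - 1) * p + 1) / ((a - 1) * p + 1)) * e ^ p := by
  set b := (a - 1) * p with hb
  have hexp : 1 + a * p = p + (b + 1) := by rw [hb]; ring
  have hb1 : 0 < b + 1 := by linarith
  rw [shiftCost, ← hb, integral_rpow (Or.inl h), hexp, Real.rpow_add he]
  calc e ^ p * e ^ (b + 1) + e ^ p * (((1 + e) ^ (b + 1) - e ^ (b + 1)) / (b + 1))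
      ≤ e ^ p * M ^ (b + 1) + e ^ p * ((1 + M) ^ (b + 1) / (b + 1)) := by
        gcongr
        exact (sub_le_self _ (by positivity)).trans (by gcongr)
    _ = _ := by ring

lemma shiftCost_of_eq (h : (a - 1) * p = -1) (he : 0 < e) :
    shiftCost p a e = e ^ p * (1 + Real.log ((1 + e) / e)) := by
  rw [shiftCost, h]
  simp_rw [Real.rpow_neg_one]
  rw [integral_inv (notMem_uIcc_add_one he), show 1 + a * p = p by linarith]
  ring

lemma exists_shiftCost_le_rpow (hM : 0 < M) (hne : (a - 1) * p ≠ -1) :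
    ∃ C : ℝ, 0 < C ∧ ∀ x : ℝ, 0 < x → x ≤ 1 →
      shiftCost p a (M * x) ≤ C * x ^ min p (1 + a * p) := by
  rcases lt_or_gt_of_ne hne with h | h
  · have hb1 : 0 < -((a - 1) * p + 1) := by linarith
    refine ⟨(1 + 1 / -((a - 1) * p + 1)) * M ^ (1 + a * p), by positivity, fun x hx _ => ?_⟩
    rw [min_eq_right (by linarith), mul_assoc, ← Real.mul_rpow hM.le hx.le]
    exact shiftCost_le_of_lt h (mul_pos hM hx)
  · have hb1 : 0 < (a - 1) * p + 1 := by linarith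
    refine ⟨(M ^ ((a - 1) * p + 1) + (1 + M) ^ ((a - 1) * p + 1) / ((a - 1) * p + 1)) * M ^ p,
      by positivity, fun x hx hx1 => ?_⟩
    rw [min_eq_left (by linarith), mul_assoc, ← Real.mul_rpow hM.le hx.le]
    exact shiftCost_le_of_gt h (mul_pos hM hx) (mul_le_of_le_one_right hM.le hx1)

lemma exists_shiftCost_le_log (hM : 0 < M) (heq : (a - 1) * p = -1) :
    ∃ C : ℝ, 0 < C ∧ ∀ x : ℝ, 0 < x → x ≤ 1 →
      shiftCost p a (M * x) ≤ C * (x ^ p * (Real.log (1 / x) + 1)) := by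
  have hlogM : 0 ≤ Real.log ((1 + M) / M) := Real.log_nonneg ((one_le_div hM).2 (by linarith))
  refine ⟨M ^ p * (1 + Real.log ((1 + M) / M)), by positivity, fun x hx hx1 => ?_⟩
  have he : 0 < M * x := by positivity
  have hlogx : 0 ≤ Real.log (1 / x) := Real.log_nonneg ((one_le_div hx).2 hx1)
  have hlog : Real.log ((1 + M * x) / (M * x)) ≤ Real.log ((1 + M) / M) + Real.log (1 / x) := by
    rw [← Real.log_mul (by positivity) (by positivity), div_mul_div_comm, mul_one]
    exact Real.log_le_log (by positivity) (by gcongr; nlinarith)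
  calc shiftCost p a (M * x) = M ^ p * x ^ p * (1 + Real.log ((1 + M * x) / (M * x))) := by
        rw [shiftCost_of_eq heq he, Real.mul_rpow hM.le hx.le]
    _ ≤ M ^ p * x ^ p * ((1 + Real.log ((1 + M) / M)) * (Real.log (1 / x) + 1)) := by
        gcongr
        nlinarith
    _ = _ := by ring

lemma div_sub_one_eq_iff (hp : 1 < p) (hd : 0 < d) :
    p / (p - 1) = d ↔ (1 / d - 1) * p = -1 := by
  rw [div_eq_iff (sub_pos.2 hp).ne']
  field_simp
  constructor <;> intro h <;> linarith

lemma mul_min_one_add (hp : 0 < p) : p * min 1 (1 / d + 1 / p) = min p (1 + 1 / d * p) := by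
  rw [mul_min_of_nonneg _ _ hp.le, mul_one]
  congr 1
  field_simp
  ring

lemma rpow_one_div_mul_min (hp : 0 < p) {C θ : ℝ} (hC : 0 ≤ C) (hx : 0 ≤ x) :
    (C * (x ^ θ) ^ min p (1 + 1 / d * p)) ^ (1 / p) =
      C ^ (1 / p) * x ^ (min 1 (1 / d + 1 / p) * θ) := by
  rw [Real.mul_rpow hC (by positivity), ← mul_min_one_add hp, ← Real.rpow_mul (by positivity),
    ← Real.rpow_mul hx]
  congr 2
  field_simp

lemma rpow_one_div_mul_log_le (hp : 1 ≤ p) {C θ : ℝ} (hC : 0 ≤ C) (hθ : 0 ≤ θ) (hθ1 : θ ≤ 1)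
    (hx : 0 < x) (hx1 : x ≤ 1) :
    (C * ((x ^ θ) ^ p * (Real.log (1 / x ^ θ) + 1))) ^ (1 / p) ≤
      C ^ (1 / p) * (x ^ θ * (Real.posLog (1 / x) ^ (1 / p) + 1)) := by
  have hp0 : 0 < p := one_pos.trans_le hp
  have hlog0 : 0 ≤ Real.log (1 / x) := Real.log_nonneg ((one_le_div hx).2 hx1)
  have hlog : Real.log (1 / x ^ θ) = θ * Real.log (1 / x) := by
    rw [one_div, one_div, ← Real.inv_rpow hx.le, Real.log_rpow (inv_pos.2 hx)]
  have hlogθ : 0 ≤ Real.log (1 / x ^ θ) := by rw [hlog]; positivity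
  rw [Real.mul_rpow hC (by positivity), Real.mul_rpow (by positivity) (by positivity),
    ← Real.rpow_mul (by positivity), mul_one_div_cancel hp0.ne', Real.rpow_one]
  gcongr
  calc (Real.log (1 / x ^ θ) + 1) ^ (1 / p) ≤ Real.log (1 / x ^ θ) ^ (1 / p) + 1 ^ (1 / p) :=
        Real.rpow_add_le_add_rpow hlogθ zero_le_one (by positivity) ((div_le_one hp0).2 hp)
    _ ≤ Real.posLog (1 / x) ^ (1 / p) + 1 := by
        rw [Real.one_rpow]
        gcongr
        rw [hlog]
        exact (mul_le_of_le_one_left hlog0 hθ1).trans (le_max_right _ _)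

end Rates

section Curves

variable {I : Set ℝ} {r : ℝ≥0∞} {p d : ℝ}

lemma one_sub_toReal_inv_mem_Icc (hr : 1 ≤ r) : 1 - (r⁻¹).toReal ∈ Set.Icc (0 : ℝ) 1 :=
  ⟨sub_nonneg.2 (ENNReal.toReal_le_of_le_ofReal zero_le_one (by simpa using hr)),
    sub_le_self _ ENNReal.toReal_nonneg⟩

lemma intervalIntegral_le_eLpNorm_mul_rpow (hr : 1 ≤ r) {m : ℝ → ℝ} {τ t : ℝ} (hτt : τ < t)
    (hm : MemLp m r (volume.restrict (Set.Ioc τ t))) :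
    ∫ s in τ..t, m s ≤
      (eLpNorm m r (volume.restrict (Set.Ioc τ t))).toReal * (t - τ) ^ (1 - (r⁻¹).toReal) := by
  have holder := eLpNorm_le_eLpNorm_mul_rpow_measure_univ hr hm.aestronglyMeasurable
  rw [Measure.restrict_apply_univ, Real.volume_Ioc, ENNReal.toReal_one, div_one, one_div,
    ← ENNReal.toReal_inv, ENNReal.ofReal_rpow_of_pos (sub_pos.2 hτt),
    eLpNorm_one_eq_lintegral_enorm] at holder
  have hnorm := (enorm_integral_le_lintegral_enorm m).trans holder
  rw [intervalIntegral.integral_of_le hτt.le]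
  calc _ ≤ ‖∫ s in Set.Ioc τ t, m s‖ₑ.toReal := by simpa using le_abs_self _
    _ ≤ _ := ENNReal.toReal_mono (ENNReal.mul_ne_top hm.eLpNorm_ne_top ENNReal.ofReal_ne_top)
        hnorm
    _ = _ := by rw [ENNReal.toReal_mul,
        ENNReal.toReal_ofReal (Real.rpow_nonneg (sub_pos.2 hτt).le _)]

lemma IsACTV.exists_tvDist_le {X : Type*} [MeasurableSpace X] (hI : I.OrdConnected) (hr : 1 ≤ r)
    {μ : I → ProbabilityMeasure X} (hμ : IsACTV I r μ) :
    ∃ M : ℝ, 0 < M ∧ ∀ τ t : I, τ < t →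
      tvDist (μ t) (μ τ) ≤ M * ((t : ℝ) - τ) ^ (1 - (r⁻¹).toReal) := by
  obtain ⟨m, -, hm, hle⟩ := hμ
  refine ⟨(eLpNorm m r (volume.restrict I)).toReal + 1, by positivity, fun τ t hτt => ?_⟩
  have hτt' : (τ : ℝ) < t := hτt
  have hJI : volume.restrict (Set.Ioc (τ : ℝ) t) ≤ volume.restrict I :=
    Measure.restrict_mono_set _ (Set.Ioc_subset_Icc_self.trans (hI.out τ.2 t.2))
  refine ((hle τ t hτt).trans
    (intervalIntegral_le_eLpNorm_mul_rpow hr hτt' (hm.mono_measure hJI))).trans ?_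
  have hnorm := ENNReal.toReal_mono hm.eLpNorm_ne_top (eLpNorm_mono_measure m hJI)
  exact mul_le_mul_of_nonneg_right (hnorm.trans (by linarith))
    (Real.rpow_nonneg (sub_pos.2 hτt').le _)

variable {X : Type*} [MetricSpace X] [CompactSpace X] [MeasurableSpace X] [BorelSpace X]
  {μ : I → ProbabilityMeasure X}

lemma wasserstein_le_diam (hp : 0 < p) (μ ν : ProbabilityMeasure X) :
    wasserstein p μ ν ≤ ENNReal.ofReal (Metric.diam (Set.univ : Set X)) := by
  refine (DistRpowCostLE.of_diam hp.le).wasserstein_le hp |>.trans_eq ?_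
  rw [← Real.rpow_mul Metric.diam_nonneg, mul_one_div_cancel hp.ne', Real.rpow_one]

lemma wasserstein_self (hp : 0 < p) (μ : ProbabilityMeasure X) : wasserstein p μ μ = 0 := by
  simpa [hp.ne'] using (DistRpowCostLE.refl hp (μ : Measure X)).wasserstein_le hp

lemma exists_wasserstein_le_of_close {C : ℝ} (hp : 0 < p) {F : ℝ → ℝ}
    (hF : ∀ g, 1 ≤ g → 1 ≤ F g) (hF0 : ∀ g, 0 < g → 0 ≤ F g) (hC : 0 < C)
    (h : ∀ τ t : I, τ < t → (t : ℝ) - τ ≤ 1 → ∃ B,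
      DistRpowCostLE p (μ τ : Measure X) (μ t) B ∧ B ^ (1 / p) ≤ C * F (t - τ)) :
    ∃ C : ℝ, 0 < C ∧ ∀ t τ : I,
      wasserstein p (μ t) (μ τ) ≤ ENNReal.ofReal (C * F |(t : ℝ) - τ|) := by
  have hdiam : 0 ≤ Metric.diam (Set.univ : Set X) := Metric.diam_nonneg
  refine ⟨C + Metric.diam (Set.univ : Set X), by positivity, fun t τ => ?_⟩
  rcases eq_or_ne t τ with rfl | hne
  · exact (wasserstein_self hp _).trans_le zero_le
  have hg : 0 < |(t : ℝ) - τ| := abs_pos.2 (sub_ne_zero.2 (Subtype.coe_ne_coe.2 hne))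
  rcases le_total 1 |(t : ℝ) - τ| with hfar | hclose
  · refine (wasserstein_le_diam hp _ _).trans (ENNReal.ofReal_le_ofReal ?_)
    nlinarith [hF _ hfar]
  · obtain ⟨B, hB, hle⟩ : ∃ B, DistRpowCostLE p (μ t : Measure X) (μ τ) B ∧
        B ^ (1 / p) ≤ C * F |(t : ℝ) - τ| := by
      rcases lt_or_gt_of_ne hne with hlt | hlt
      · rw [abs_sub_comm, abs_of_pos (sub_pos.2 (Subtype.coe_lt_coe.2 hlt))] at hclose ⊢
        exact h t τ hlt hclose
      · rw [abs_of_pos (sub_pos.2 (Subtype.coe_lt_coe.2 hlt))] at hclose ⊢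
        obtain ⟨B, hB, hle⟩ := h τ t hlt hclose
        exact ⟨B, hB.symm, hle⟩
    refine (hB.wasserstein_le hp).trans (ENNReal.ofReal_le_ofReal (hle.trans ?_))
    exact mul_le_mul_of_nonneg_right (by linarith) (hF0 _ hg)

lemma exists_distRpowCostLE_curve (hp : 1 < p) (hd : 0 < d) (hI : I.OrdConnected) (hr : 1 ≤ r)
    (hAC : IsACTV I r μ) (hsupp : ∀ τ t : I, τ < t → supp (μ t) ⊆ supp (μ τ))
    (hconn : UniformlyStronglyConnected.{v} d μ) :
    ∃ M C : ℝ, 0 < M ∧ 0 < C ∧ ∀ τ t : I, τ < t →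
      DistRpowCostLE p (μ τ : Measure X) (μ t)
        (C * shiftCost p (1 / d) (M * ((t : ℝ) - τ) ^ (1 - (r⁻¹).toReal))) := by
  obtain ⟨L, K, N, hL, hK, -, hconn⟩ := hconn
  obtain ⟨M, hM, htv⟩ := hAC.exists_tvDist_le hI hr
  obtain ⟨c, C, hc, hC, hmove⟩ := exists_distRpowCostLE_of_stronglyConnectedWith X hd hK hL N hp.le
  obtain ⟨A, hA, hmid⟩ := DistRpowCostLE.exists_of_midpoint X hp
  refine ⟨c * M, A * C, by positivity, by positivity, fun τ t hτt => ?_⟩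
  have hg : 0 < (t : ℝ) - τ := sub_pos.2 hτt
  have he : 0 < M * ((t : ℝ) - τ) ^ (1 - (r⁻¹).toReal) := by positivity
  rw [mul_assoc A, mul_assoc c]
  exact hmid _ _ _ (.add_self_add (e := ⟨_, he.le⟩) (by linarith) (hsupp τ t hτt) (htv τ t hτt)
    (mul_nonneg hC.le (shiftCost_nonneg (by positivity))) (hmove (μ τ) (hconn τ) _ he))

lemma exists_wasserstein_le_rpow (hI : I.OrdConnected) (hr : 1 ≤ r) (hd : 0 < d)
    (hAC : IsACTV I r μ) (hsupp : ∀ τ t : I, τ < t → supp (μ t) ⊆ supp (μ τ))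
    (hconn : UniformlyStronglyConnected.{v} d μ) (hp : 1 < p) (hne : (1 / d - 1) * p ≠ -1) :
    ∃ C : ℝ, 0 < C ∧ ∀ t τ : I, wasserstein p (μ t) (μ τ) ≤
      ENNReal.ofReal (C * |(t : ℝ) - τ| ^ (min 1 (1 / d + 1 / p) * (1 - (r⁻¹).toReal))) := by
  have hp0 : 0 < p := one_pos.trans hp
  obtain ⟨M, C, hM, hC, hcurve⟩ := exists_distRpowCostLE_curve hp hd hI hr hAC hsupp hconn
  obtain ⟨C', hC', hcost⟩ := exists_shiftCost_le_rpow hM hne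
  have hθ := (one_sub_toReal_inv_mem_Icc hr).1
  set θ := 1 - (r⁻¹).toReal
  refine exists_wasserstein_le_of_close (C := (C * C') ^ (1 / p)) hp0
    (fun g hg => Real.one_le_rpow hg (by positivity)) (fun g hg => by positivity) (by positivity)
    fun τ t hτt hclose => ?_
  have hg : 0 < (t : ℝ) - τ := sub_pos.2 hτt
  refine ⟨_, (hcurve τ t hτt).mono (mul_le_mul_of_nonneg_left
    (hcost _ (by positivity) (Real.rpow_le_one hg.le hclose hθ)) hC.le), le_of_eq ?_⟩
  rw [← mul_assoc, rpow_one_div_mul_min hp0 (by positivity) hg.le]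

lemma exists_wasserstein_le_log (hI : I.OrdConnected) (hr : 1 ≤ r) (hd : 0 < d)
    (hAC : IsACTV I r μ) (hsupp : ∀ τ t : I, τ < t → supp (μ t) ⊆ supp (μ τ))
    (hconn : UniformlyStronglyConnected.{v} d μ) (hp : 1 < p) (heq : (1 / d - 1) * p = -1) :
    ∃ C : ℝ, 0 < C ∧ ∀ t τ : I, wasserstein p (μ t) (μ τ) ≤
      ENNReal.ofReal (C * |(t : ℝ) - τ| ^ (1 - (r⁻¹).toReal) *
        (Real.posLog (1 / |(t : ℝ) - τ|) ^ (1 / p) + 1)) := by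
  have hp0 : 0 < p := one_pos.trans hp
  obtain ⟨M, C, hM, hC, hcurve⟩ := exists_distRpowCostLE_curve hp hd hI hr hAC hsupp hconn
  obtain ⟨C', hC', hcost⟩ := exists_shiftCost_le_log hM heq
  obtain ⟨hθ, hθ1⟩ := one_sub_toReal_inv_mem_Icc hr
  set θ := 1 - (r⁻¹).toReal
  have hlog (g : ℝ) : 0 ≤ Real.posLog (1 / g) ^ (1 / p) := Real.rpow_nonneg Real.posLog_nonneg _
  simp only [mul_assoc]
  refine exists_wasserstein_le_of_close (C := (C * C') ^ (1 / p)) hp0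
    (F := fun g => g ^ θ * (Real.posLog (1 / g) ^ (1 / p) + 1))
    (fun g hg => one_le_mul_of_one_le_of_one_le (Real.one_le_rpow hg hθ) (by linarith [hlog g]))
    (fun g hg => mul_nonneg (by positivity) (by linarith [hlog g])) (by positivity)
    fun τ t hτt hclose => ?_
  have hg : 0 < (t : ℝ) - τ := sub_pos.2 hτt
  refine ⟨_, (hcurve τ t hτt).mono (mul_le_mul_of_nonneg_left
    (hcost _ (by positivity) (Real.rpow_le_one hg.le hclose hθ)) hC.le), ?_⟩
  rw [← mul_assoc]
  exact rpow_one_div_mul_log_le hp.le (by positivity) hθ hθ1 hg hclose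

end Curves

theorem theorem2_general {X : Type*} [MetricSpace X] [CompactSpace X] [MeasurableSpace X]
    [BorelSpace X] {I : Set ℝ} (hI : I.OrdConnected) {r : ℝ≥0∞} (hr : 1 ≤ r) {d : ℝ} (hd : 0 < d)
    (μ : I → ProbabilityMeasure X) (hAC : IsACTV I r μ)
    (hsupp : ∀ τ t : I, τ < t → supp (μ t) ⊆ supp (μ τ))
    (hconn : UniformlyStronglyConnected.{v} d μ) {p : ℝ} (hp : 1 < p) :
    (p / (p - 1) ≠ d → ∃ C : ℝ, 0 < C ∧ ∀ t τ : I, wasserstein p (μ t) (μ τ) ≤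
      ENNReal.ofReal (C * |(t : ℝ) - τ| ^ (min 1 (1 / d + 1 / p) * (1 - (r⁻¹).toReal)))) ∧
    (p / (p - 1) = d → ∃ C : ℝ, 0 < C ∧ ∀ t τ : I, wasserstein p (μ t) (μ τ) ≤
      ENNReal.ofReal (C * |(t : ℝ) - τ| ^ (1 - (r⁻¹).toReal) *
        (Real.posLog (1 / |(t : ℝ) - τ|) ^ (1 / p) + 1))) := by
  rw [ne_eq, div_sub_one_eq_iff hp hd]
  exact ⟨exists_wasserstein_le_rpow hI hr hd hAC hsupp hconn hp,
    exists_wasserstein_le_log hI hr hd hAC hsupp hconn hp⟩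

theorem theorem2 {k : ℕ} {Ω : Set (EuclideanSpace ℝ (Fin k))} (hΩ : IsCompact Ω)
    {I : Set ℝ} (hI : I.OrdConnected) {r : ℝ≥0∞} (hr : 1 < r) {d : ℝ} (hd : 0 < d)
    (μ : I → ProbabilityMeasure Ω) (hAC : IsACTV I r μ)
    (hsupp : ∀ τ t : I, τ < t → supp (μ t) ⊆ supp (μ τ))
    (hconn : UniformlyStronglyConnected.{v} d μ) :
    (∀ p : ℝ, 1 < p → p / (p - 1) ≠ d →
      ∃ C : ℝ, 0 < C ∧ ∀ t τ : I, wasserstein p (μ t) (μ τ) ≤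
        ENNReal.ofReal (C * |(t : ℝ) - τ| ^ (min 1 (1 / d + 1 / p) * (1 - (r⁻¹).toReal)))) ∧
    (r = ∞ → ∀ p : ℝ, 1 < p → p / (p - 1) = d →
      ∃ C : ℝ, 0 < C ∧ ∀ t τ : I, wasserstein p (μ t) (μ τ) ≤
        ENNReal.ofReal (C * |(t : ℝ) - τ| *
          (Real.posLog (1 / |(t : ℝ) - τ|) ^ (1 / p) + 1))) := by
  have : CompactSpace Ω := isCompact_iff_compactSpace.1 hΩ
  have h {p : ℝ} (hp : 1 < p) := theorem2_general hI hr.le hd μ hAC hsupp hconn hp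
  exact ⟨fun p hp => (h hp).1, by rintro rfl p hp; simpa using (h hp).2⟩
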